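/- Let $\mathcal S_0$ be the $(1,\infty)$-RLL constraint, i.e. the set of finite words over $\{1,2\}$ that do not contain $22$ as a contiguous subword. For $\varepsilon\in[0,1)$ consider the binary erasure channel $Y_n=X_nE_n$, where $\{E_n\}$ is i.i.d. with $P(E_n=0)=\varepsilon$, $P(E_n=1)=1-\varepsilon$, and is independent of the input $\{X_n\}$. The input is a stationary first-order Markov chain on $\{1,2\}$ supported on $\mathcal S_0$ (every word of positive probability lies in $\mathcal S_0$). Logarithms are natural, $I(X;Y)=\lim_{n\to\infty}\frac1n I(X_1^n;Y_1^n)$ is the mutual information rate, and $C^{(1)}(\mathcal S_0,\varepsilon)$ is the supremum of $I(X;Y)$ over all such inputs. For $\theta\in[0,1]$ let $X$ be the stationary chain with transition matrix $\begin{bmatrix}1-\theta&\theta\\1&0\end{bmatrix}$ and stationary law $\left(\frac1{1+\theta},\frac\theta{1+\theta}\right)$; then $I(X;Y)$ and $H_k(\theta):=H(X_0|X_{-k-1})$ ($k\ge0$) are functions of $\theta$. Let $\lambda=(1+\sqrt5)/2$. The limit defining $I(X;Y)$ exists for every such input. For every $\varepsilon\in[0,1)$ the function $\theta\mapsto I(X;Y)$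 has a unique maximizer $\theta_{\max}(\varepsilon)$ on $[0,1]$, the supremum $C^{(1)}(\mathcal S_0,\varepsilon)$ is finite and equal to the value of $I(X;Y)$ at $\theta_{\max}(\varepsilon)$, and $\theta_{\max}(0)=1/\lambda^2$. Moreover (derivatives at $\varepsilon=0$ are taken from the right): a) $\theta_{\max}$ is analytic on $[0,1)$, $H_0''(1/\lambda^2)\neq0$, and for all $n\ge1$ $$\theta_{\max}^{(n)}(0)=-\Big(H_0''\big(\tfrac1{\lambda^2}\big)\Big)^{-1}\Big\{\sum_{k=1}^{n}\binom nk k!\sum_{m_1,\dots,m_{n-k}}a(m_1,\dots,m_{n-k})\,H_k^{(m_1+\cdots+m_{n-k}+1)}\big(\tfrac1{\lambda^2}\big)\prod_{j=1}^{n-k}\big(\theta_{\max}^{(j)}(0)\big)^{m_j}$$ $$\qquad+\sum_{m_1,\dots,m_n:\ m_n=0}a(m_1,\dots,m_n)\,H_0^{(m_1+\cdots+m_n+1)}\big(\tfrac1{\lambda^2}\big)\prod_{j=1}^{n}\big(\theta_{\max}^{(j)}(0)\big)^{m_j}\Big\},$$ where the sums over $m_1,\dots,m_N$ run over all nonnegative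 integers with $m_1+2m_2+\cdots+Nm_N=N$ (for $N=0$ there is just the empty tuple), and $$a(m_1,\dots,m_N)=\frac{N!}{m_1!\,(1!)^{m_1}\cdots m_N!\,(N!)^{m_N}}.$$ b) $C^{(1)}(\mathcal S_0,\varepsilon)$ and the functions $G_k(\varepsilon):=H_k(\theta_{\max}(\varepsilon))$, $k\ge0$, are analytic in $\varepsilon$ on $[0,1)$, and for all sufficiently small $\varepsilon\ge0$ $$C^{(1)}(\mathcal S_0,\varepsilon)=\sum_{n=0}^\infty\frac1{n!}\Big(G_0^{(n)}(0)+n\,(G_1-2G_0)^{(n-1)}(0)+\sum_{k=2}^n\binom nk k!\,(G_k+G_{k-2}-2G_{k-1})^{(n-k)}(0)\Big)\varepsilon^n,$$ where the second summand is $0$ for $n=0$. -/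

import Mathlib

open Set Filter Topology
open scoped Nat

noncomputable section

namespace BEC

/-! ### Information quantities of finite distributions (natural logarithm) -/

/-- First marginal of a joint law. -/
def fstLaw {α β : Type} [Fintype β] (p : α × β → ℝ) (a : α) : ℝ := ∑ b, p (a, b)

/-- Second marginal of a joint law. -/
def sndLaw {α β : Type} [Fintype α] (p : α × β → ℝ) (b : β) : ℝ := ∑ a, p (a, b)

/-- Conditional entropy `H(B | A)` of a pair `(A, B)` with joint law `p`. -/
def condEntropy {α β : Type} [Fintype α] [Fintype β] (p : α × β → ℝ) : ℝ :=
  -∑ z, p z * Real.log (p z / fstLaw p z.1)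

/-- Mutual information `I(A; B)` of a pair `(A, B)` with joint law `p`. -/
def mutualInfo {α β : Type} [Fintype α] [Fintype β] (p : α × β → ℝ) : ℝ :=
  ∑ z, p z * Real.log (p z / (fstLaw p z.1 * sndLaw p z.2))

/-! ### Stationary first-order Markov chains on a two-letter alphabet -/

/-- The input alphabet `{1, 2}`: the index `0` is the letter `1`, the index `1` the letter `2`. -/
abbrev Letter : Type := Fin 2

/-- `π` and `P` are the initial law and the transition matrix of a stationary Markov chain. -/
structure IsStationaryChain (π : Letter → ℝ) (P : Matrix Letter Letter ℝ) : Prop where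
  init_nonneg : ∀ a, 0 ≤ π a
  init_sum : ∑ a, π a = 1
  trans_nonneg : ∀ a b, 0 ≤ P a b
  trans_sum : ∀ a, ∑ b, P a b = 1
  stationary : ∀ b, ∑ a, π a * P a b = π b

/-- The law of `n + 1` consecutive letters of the chain. -/
def blockLaw (π : Letter → ℝ) (P : Matrix Letter Letter ℝ) (n : ℕ)
    (x : Fin (n + 1) → Letter) : ℝ :=
  π (x 0) * ∏ i : Fin n, P (x i.castSucc) (x i.succ)

/-- The joint law of `(X_{-k-1}, X_0)`. -/
def pairLaw (π : Letter → ℝ) (P : Matrix Letter Letter ℝ) (k : ℕ) (z : Letter × Letter) : ℝ :=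
  ∑ x : Fin (k + 2) → Letter,
    if x 0 = z.1 ∧ x (Fin.last (k + 1)) = z.2 then blockLaw π P (k + 1) x else 0

/-- The `(1, ∞)`-RLL constraint: the words over `{1, 2}` in which `22` does not occur. -/
def rllConstraint : Set (List Letter) := {w | ¬ [1, 1] <:+: w}

/-- All words of positive probability belong to the set of words `S`. -/
def SupportedOn (S : Set (List Letter)) (π : Letter → ℝ) (P : Matrix Letter Letter ℝ) : Prop :=
  ∀ (n : ℕ) (x : Fin (n + 1) → Letter), 0 < blockLaw π P n x → List.ofFn x ∈ S

/-! ### The binary erasure channel -/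

/-- The law of one erasure variable `E`: `P(E = 0) = ε` and `P(E = 1) = 1 - ε`. -/
def erasureLaw (ε : ℝ) (e : Bool) : ℝ := if e then 1 - ε else ε

/-- The channel output: the letter itself where `E = 1`, the erasure symbol `none` where `E = 0`. -/
def channelOutput {n : ℕ} (x : Fin n → Letter) (e : Fin n → Bool) : Fin n → Option Letter :=
  fun i => if e i then some (x i) else none

/-- The joint law of input and output block, for an input block of law `q` and i.i.d. erasures
that are independent of the input. -/
def jointLaw (ε : ℝ) {n : ℕ} (q : (Fin n → Letter) → ℝ)
    (z : (Fin n → Letter) × (Fin n → Option Letter)) : ℝ :=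
  ∑ e : Fin n → Bool, if z.2 = channelOutput z.1 e then q z.1 * ∏ i, erasureLaw ε (e i) else 0

/-- The mutual information per letter of input and output blocks of length `n + 1`. -/
def blockInfo (ε : ℝ) (π : Letter → ℝ) (P : Matrix Letter Letter ℝ) (n : ℕ) : ℝ :=
  mutualInfo (jointLaw ε (blockLaw π P n)) / ((n : ℝ) + 1)

/-- The mutual information rate `I(X; Y)`. -/
def infoRate (ε : ℝ) (π : Letter → ℝ) (P : Matrix Letter Letter ℝ) : ℝ :=
  limUnder atTop (blockInfo ε π P)

/-- The mutual information rates of the stationary first-order Markov inputs supported on the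
`(1, ∞)`-RLL constraint. -/
def markovRates (ε : ℝ) : Set ℝ :=
  {r | ∃ (π : Letter → ℝ) (P : Matrix Letter Letter ℝ),
    IsStationaryChain π P ∧ SupportedOn rllConstraint π P ∧ r = infoRate ε π P}

/-- The first-order Markov capacity of the erasure channel under the `(1, ∞)`-RLL constraint. -/
def markovCapacity (ε : ℝ) : ℝ := sSup (markovRates ε)

/-! ### The one-parameter family of inputs -/

/-- The transition matrix with parameter `θ`. -/
def rllTrans (θ : ℝ) : Matrix Letter Letter ℝ := !![1 - θ, θ; 1, 0]

/-- The stationary law of `rllTrans θ`. -/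
def rllInit (θ : ℝ) : Letter → ℝ := ![1 / (1 + θ), θ / (1 + θ)]

theorem isStationaryChain_rll {θ : ℝ} (h : θ ∈ Icc (0 : ℝ) 1) :
    IsStationaryChain (rllInit θ) (rllTrans θ) := by
  obtain ⟨h0, h1⟩ := h
  have h2 : (1 + θ) ≠ 0 := by positivity
  refine ⟨?_, ?_, ?_, ?_, ?_⟩
  · intro a
    fin_cases a <;> simp [rllInit] <;> positivity
  · simp [rllInit]
    field_simp
  · intro a b
    fin_cases a <;> fin_cases b <;> simp [rllTrans, h0, h1]
  · intro a
    fin_cases a <;> simp [rllTrans]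
  · intro b
    fin_cases b <;> simp [rllTrans, rllInit] <;> field_simp
    ring

/-- `I(X; Y)` as a function of the parameter. -/
def rllRate (ε θ : ℝ) : ℝ := infoRate ε (rllInit θ) (rllTrans θ)

/-- `H(X_0 | X_{-k-1})` as a function of the parameter. -/
def rllCondEntropy (k : ℕ) (θ : ℝ) : ℝ := condEntropy (pairLaw (rllInit θ) (rllTrans θ) k)

/-- `θ` is the unique maximizer of `I(X; Y)` over `[0, 1]`. -/
def IsOptimalParam (ε θ : ℝ) : Prop :=
  θ ∈ Icc (0 : ℝ) 1 ∧ ∀ s ∈ Icc (0 : ℝ) 1, s ≠ θ → rllRate ε s < rllRate ε θ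

/-! ### The terms of the Faà di Bruno formula -/

/-- The tuples `(m₁, …, m_N)` of natural numbers with `m₁ + 2 m₂ + ⋯ + N m_N = N`;
`m i` is the entry with the number `i + 1`. -/
def bruno (N : ℕ) : Finset (Fin N → ℕ) :=
  (Fintype.piFinset fun _ => Finset.range (N + 1)).filter fun m =>
    ∑ i : Fin N, ((i : ℕ) + 1) * m i = N

/-- `N! / (m₁! 1!^{m₁} ⋯ m_N! N!^{m_N})`. -/
def brunoCoeff {N : ℕ} (m : Fin N → ℕ) : ℝ :=
  (N ! : ℝ) / (∏ i : Fin N, ((m i)! : ℝ) * (((i : ℕ) + 1)! : ℝ) ^ m i)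

/-- The summand of the Faà di Bruno formula that belongs to the tuple `m`, for the derivative of
order `N` of `F' ∘ θ` at a point that `θ` maps to `t`; `d j` is the `j`-th derivative of `θ`. -/
def brunoTerm (F : ℝ → ℝ) (t : ℝ) (d : ℕ → ℝ) {N : ℕ} (m : Fin N → ℕ) : ℝ :=
  brunoCoeff m * iteratedDeriv ((∑ i, m i) + 1) F t * (∏ i : Fin N, d ((i : ℕ) + 1) ^ m i)

/-- The derivative of order `n` at `0`, from the right, of a function on `[0, 1)`. -/
def derivAtZero (f : ℝ → ℝ) (n : ℕ) : ℝ := iteratedDerivWithin n f (Ico 0 1) 0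

/-- The function `G_k(ε) = H(X_0 | X_{-k-1})(θmax(ε))`. -/
def entropyAlong (θmax : ℝ → ℝ) (k : ℕ) (ε : ℝ) : ℝ := rllCondEntropy k (θmax ε)

/-- The derivative of order `n` of the capacity at `0` in terms of the functions `G k`. For `n = 0`
the second summand has the factor `0` and the third is an empty sum. -/
def capacityCoeff (G : ℕ → ℝ → ℝ) (n : ℕ) : ℝ :=
  derivAtZero (G 0) n
    + n * derivAtZero (fun ε => G 1 ε - 2 * G 0 ε) (n - 1)
    + ∑ k ∈ Finset.Icc 2 n, (n.choose k : ℝ) * (k ! : ℝ) *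
        derivAtZero (fun ε => G k ε + G (k - 2) ε - 2 * G (k - 1) ε) (n - k)

end BEC

end

/-!
By the chain rule, a new visible letter of the word adds to the mutual information its entropy given
the last visible letter, which lies `k + 1` steps back with probability `(1 - ε) * ε ^ k`; hence the
rate equals `(1 - ε) ^ 2 * ∑ ε ^ k * H_k(θ)`. As a function of the probability `t = θ / (1 + θ)` of
the letter `2` every `H_k` is concave, and `H_0` strictly, so the rate has exactly one
critical point. The bounded sequence `(H_k(θ))_k` is an analytic curve in `ℓ^∞`, hence the critical
equation `∑ ε ^ k * H_k'(θ) = 0` can be solved by the implicit function theorem near every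
`ε ∈ [0, 1)`, which gives analyticity. Differentiating this equation `n` times at `ε = 0` by the
Leibniz rule and Faà di Bruno's formula isolates the `n`-th derivative of the optimal parameter, and
the factor `(1 - ε) ^ 2` produces the second differences of `H_k` in the series of the capacity.
-/

noncomputable section

namespace BEC

open scoped Matrix BoundedContinuousFunction ContDiff

/-! ### Mutual information across the erasure channel -/

section VisibleEntropy

variable {α : Type*} [Fintype α]

lemma sum_fin_succ_arrow {N : ℕ} (f : (Fin (N + 1) → α) → ℝ) :
    ∑ x, f x = ∑ a, ∑ y : Fin N → α, f (Fin.cons a y) := by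
  rw [← (Fin.consEquiv fun _ => α).sum_comp, Fintype.sum_prod_type]
  rfl

variable [DecidableEq α]

/-- The law of the letters left visible by the erasure pattern `e`, for a word of law `q`: the total
mass of the words that agree with `x` where `e` is true. -/
def visibleLaw {n : ℕ} (q : (Fin n → α) → ℝ) (e : Fin n → Bool) (x : Fin n → α) : ℝ :=
  ∑ x', if ∀ i, e i = true → x' i = x i then q x' else 0

/-- The entropy of the visible letters of a word of law `q`, averaged over the i.i.d. erasure
patterns. It is defined for vectors `q` of any total mass, so that a law can be split according to
the first letter. -/
def visibleEntropy (ε : ℝ) {n : ℕ} (q : (Fin n → α) → ℝ) : ℝ :=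
  ∑ e : Fin n → Bool, (∏ i, erasureLaw ε (e i)) * ∑ x, q x * -Real.log (visibleLaw q e x)

lemma channelOutput_eq_iff {n : ℕ} {x x' : Fin n → Letter} {e e' : Fin n → Bool} :
    channelOutput x e = channelOutput x' e' ↔ e' = e ∧ ∀ i, e i = true → x' i = x i := by
  simp only [channelOutput, funext_iff, ← forall_and]
  refine forall_congr' fun i => ?_
  cases e i <;> cases e' i <;> simp [eq_comm]

lemma sum_prod_erasureLaw (ε : ℝ) (n : ℕ) :
    ∑ e : Fin n → Bool, ∏ i, erasureLaw ε (e i) = 1 := by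
  rw [← Fintype.prod_sum]
  simp [erasureLaw]

lemma jointLaw_channelOutput (ε : ℝ) {n : ℕ} (q : (Fin n → Letter) → ℝ)
    (x : Fin n → Letter) (e : Fin n → Bool) :
    jointLaw ε q (x, channelOutput x e) = q x * ∏ i, erasureLaw ε (e i) := by
  simp [jointLaw, channelOutput_eq_iff]

lemma fstLaw_jointLaw (ε : ℝ) {n : ℕ} (q : (Fin n → Letter) → ℝ) (x : Fin n → Letter) :
    fstLaw (jointLaw ε q) x = q x := by
  simp only [fstLaw, jointLaw]
  rw [Finset.sum_comm]
  simp [← Finset.mul_sum, sum_prod_erasureLaw]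

lemma sndLaw_jointLaw (ε : ℝ) {n : ℕ} (q : (Fin n → Letter) → ℝ)
    (x : Fin n → Letter) (e : Fin n → Bool) :
    sndLaw (jointLaw ε q) (channelOutput x e) =
      visibleLaw q e x * ∏ i, erasureLaw ε (e i) := by
  simp only [sndLaw, jointLaw, visibleLaw, Finset.sum_mul, channelOutput_eq_iff, ite_and]
  simp

lemma sum_jointLaw_mul (ε : ℝ) {n : ℕ} (q : (Fin n → Letter) → ℝ) (x : Fin n → Letter)
    (g : (Fin n → Option Letter) → ℝ) :
    ∑ y, jointLaw ε q (x, y) * g y =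
      ∑ e : Fin n → Bool, q x * (∏ i, erasureLaw ε (e i)) * g (channelOutput x e) := by
  simp only [jointLaw, Finset.sum_mul]
  rw [Finset.sum_comm]
  simp

theorem mutualInfo_jointLaw (ε : ℝ) {n : ℕ} (q : (Fin n → Letter) → ℝ) :
    mutualInfo (jointLaw ε q) = visibleEntropy ε q := by
  have log_ratio (w a m : ℝ) :
      a * w * Real.log (a * w / (a * (m * w))) = w * (a * -Real.log m) := by
    rcases eq_or_ne a 0 with rfl | ha
    · simp
    rcases eq_or_ne w 0 with rfl | hw
    · simp
    rw [← mul_assoc, mul_div_mul_right _ _ hw, div_mul_cancel_left₀ ha, Real.log_inv]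
    ring
  simp only [mutualInfo, Fintype.sum_prod_type, visibleEntropy, Finset.mul_sum]
  rw [Finset.sum_comm (s := Finset.univ (α := Fin n → Bool))]
  refine Finset.sum_congr rfl fun x _ => ?_
  rw [sum_jointLaw_mul ε q x fun y => Real.log (jointLaw ε q (x, y) /
    (fstLaw (jointLaw ε q) x * sndLaw (jointLaw ε q) y))]
  simp only [jointLaw_channelOutput, fstLaw_jointLaw, sndLaw_jointLaw, log_ratio]

lemma le_visibleLaw {n : ℕ} {q : (Fin n → α) → ℝ} (hq : 0 ≤ q) (e : Fin n → Bool)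
    (x : Fin n → α) : q x ≤ visibleLaw q e x := by
  refine le_trans (by simp) (Finset.single_le_sum
    (f := fun x' => if ∀ i, e i = true → x' i = x i then q x' else 0) (fun x' _ => ?_)
    (Finset.mem_univ x))
  split_ifs
  exacts [hq x', le_rfl]

lemma visibleLaw_const_mul {n : ℕ} (c : ℝ) (q : (Fin n → α) → ℝ) (e : Fin n → Bool)
    (x : Fin n → α) : visibleLaw (fun y => c * q y) e x = c * visibleLaw q e x := by
  simp only [visibleLaw, Finset.mul_sum, mul_ite, mul_zero]

lemma visibleLaw_cons_true {N : ℕ} (q : (Fin (N + 1) → α) → ℝ) (e : Fin N → Bool) (a : α)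
    (y : Fin N → α) :
    visibleLaw q (Fin.cons true e : Fin (N + 1) → Bool) (Fin.cons a y) =
      visibleLaw (fun y' => q (Fin.cons a y')) e y := by
  rw [visibleLaw, sum_fin_succ_arrow]
  simp only [Fin.forall_fin_succ, Fin.cons_zero, Fin.cons_succ, forall_const, ite_and]
  rw [Finset.sum_eq_single a (fun b _ hb => by simp [hb]) (by simp)]
  simp [visibleLaw]

lemma visibleLaw_cons_false {N : ℕ} (q : (Fin (N + 1) → α) → ℝ) (e : Fin N → Bool) (a : α)
    (y : Fin N → α) :
    visibleLaw q (Fin.cons false e : Fin (N + 1) → Bool) (Fin.cons a y) =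
      visibleLaw (fun y' => ∑ b, q (Fin.cons b y')) e y := by
  rw [visibleLaw, sum_fin_succ_arrow, Finset.sum_comm]
  simp only [Fin.forall_fin_succ, Fin.cons_zero, Fin.cons_succ, Bool.false_eq_true,
    IsEmpty.forall_iff, true_and, visibleLaw]
  refine Finset.sum_congr rfl fun y' _ => ?_
  split_ifs
  exacts [rfl, Finset.sum_const_zero]

lemma visibleEntropy_zero (ε : ℝ) (q : (Fin 0 → α) → ℝ) :
    visibleEntropy ε q = Real.negMulLog (q default) := by
  simp [visibleEntropy, visibleLaw, Real.negMulLog]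

theorem visibleEntropy_succ (ε : ℝ) {N : ℕ} (q : (Fin (N + 1) → α) → ℝ) :
    visibleEntropy ε q = (1 - ε) * ∑ a, visibleEntropy ε (fun y => q (Fin.cons a y)) +
      ε * visibleEntropy ε (fun y => ∑ a, q (Fin.cons a y)) := by
  rw [visibleEntropy, sum_fin_succ_arrow, Fintype.sum_bool]
  simp only [sum_fin_succ_arrow, Fin.prod_univ_succ, Fin.cons_zero, Fin.cons_succ,
    visibleLaw_cons_true, visibleLaw_cons_false, visibleEntropy]
  congr 1
  · rw [Finset.sum_comm, Finset.mul_sum]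
    simp only [erasureLaw, if_true, Finset.mul_sum, mul_assoc]
  · rw [Finset.mul_sum]
    refine Finset.sum_congr rfl fun e _ => ?_
    rw [Finset.sum_comm]
    simp only [erasureLaw, Bool.false_eq_true, if_false, Finset.sum_mul, mul_assoc]

theorem visibleEntropy_const_mul (ε c : ℝ) {n : ℕ} {q : (Fin n → α) → ℝ} (hq : 0 ≤ q) :
    visibleEntropy ε (fun y => c * q y) =
      (∑ x, q x) * Real.negMulLog c + c * visibleEntropy ε q := by
  have log_split (e : Fin n → Bool) (x : Fin n → α) :
      c * q x * -Real.log (c * visibleLaw q e x) =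
        q x * Real.negMulLog c + c * (q x * -Real.log (visibleLaw q e x)) := by
    rcases eq_or_ne c 0 with rfl | hc
    · simp
    rcases (hq x).eq_or_lt' with hx | hx
    · simp [hx]
    rw [Real.log_mul hc (hx.trans_le (le_visibleLaw hq e x)).ne', Real.negMulLog]
    ring
  simp only [visibleEntropy, visibleLaw_const_mul, log_split, Finset.sum_add_distrib,
    ← Finset.sum_mul, ← Finset.mul_sum, mul_add, sum_prod_erasureLaw, one_mul]
  simp only [mul_left_comm _ c, ← Finset.mul_sum]

end VisibleEntropy

/-! ### Markov words -/

section MarkovWords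

variable {α : Type*} [Fintype α]

/-- The law of a word of `N` letters of the Markov chain with transition matrix `P` whose first
letter has the law `v`, by recursion on the first letter. -/
def wordLaw (P : Matrix α α ℝ) : (N : ℕ) → (α → ℝ) → (Fin N → α) → ℝ
  | 0, _, _ => 1
  | N + 1, v, x => v (x 0) * wordLaw P N (P (x 0)) (Fin.tail x)

/-- The entropy of a probability vector. -/
def vecEntropy (v : α → ℝ) : ℝ := ∑ a, Real.negMulLog (v a)

lemma vecEntropy_nonneg {v : α → ℝ} (hv : v ∈ stdSimplex ℝ α) : 0 ≤ vecEntropy v :=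
  Finset.sum_nonneg fun a _ =>
    Real.negMulLog_nonneg (hv.1 a) (mem_Icc_of_mem_stdSimplex hv a).2

lemma vecEntropy_le {v : α → ℝ} (hv : v ∈ stdSimplex ℝ α) :
    vecEntropy v ≤ Fintype.card α - 1 :=
  calc vecEntropy v ≤ ∑ a, (1 - v a) :=
        Finset.sum_le_sum fun a _ => Real.negMulLog_le_one_sub_self (hv.1 a)
    _ = Fintype.card α - 1 := by simp [Finset.sum_sub_distrib, hv.2]

variable {P : Matrix α α ℝ} {v : α → ℝ}

lemma sum_mul_wordLaw (N : ℕ) (hv : v ∈ stdSimplex ℝ α) (y : Fin N → α) :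
    ∑ a, v a * wordLaw P N (P a) y = wordLaw P N (v ᵥ* P) y := by
  cases N with
  | zero => simpa [wordLaw] using hv.2
  | succ N => simp only [wordLaw, ← mul_assoc, ← Finset.sum_mul, Matrix.vecMul, dotProduct]

variable [DecidableEq α]

lemma row_mem_stdSimplex (hP : P ∈ Matrix.rowStochastic ℝ α) (a : α) : P a ∈ stdSimplex ℝ α :=
  ⟨hP.1 a, Matrix.sum_row_of_mem_rowStochastic hP a⟩

lemma wordLaw_nonneg (hP : P ∈ Matrix.rowStochastic ℝ α) {N : ℕ} (hv : v ∈ stdSimplex ℝ α) :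
    0 ≤ wordLaw P N v := by
  intro x
  induction N generalizing v with
  | zero => exact zero_le_one
  | succ N ih => exact mul_nonneg (hv.1 _) (ih (row_mem_stdSimplex hP _) _)

lemma sum_wordLaw (hP : P ∈ Matrix.rowStochastic ℝ α) {N : ℕ} (hv : v ∈ stdSimplex ℝ α) :
    ∑ x, wordLaw P N v x = 1 := by
  induction N generalizing v with
  | zero => simp [wordLaw]
  | succ N ih =>
    simp only [sum_fin_succ_arrow, wordLaw, Fin.cons_zero, Fin.tail_cons, ← Finset.mul_sum,
      ih (row_mem_stdSimplex hP _), mul_one, hv.2]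

theorem visibleEntropy_wordLaw_succ (hP : P ∈ Matrix.rowStochastic ℝ α) (ε : ℝ) (N : ℕ)
    (hv : v ∈ stdSimplex ℝ α) :
    visibleEntropy ε (wordLaw P (N + 1) v) =
      (1 - ε) * (vecEntropy v + ∑ a, v a * visibleEntropy ε (wordLaw P N (P a))) +
        ε * visibleEntropy ε (wordLaw P N (v ᵥ* P)) := by
  have row (a : α) : visibleEntropy ε (fun y => v a * wordLaw P N (P a) y) =
      Real.negMulLog (v a) + v a * visibleEntropy ε (wordLaw P N (P a)) := by
    rw [visibleEntropy_const_mul ε _ (wordLaw_nonneg hP (row_mem_stdSimplex hP a)),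
      sum_wordLaw hP (row_mem_stdSimplex hP a), one_mul]
  simp only [visibleEntropy_succ, wordLaw, Fin.cons_zero, Fin.tail_cons, row,
    Finset.sum_add_distrib, sum_mul_wordLaw N hv, vecEntropy]

lemma sum_wordLaw_first_last (a b : α) (n : ℕ) (v : α → ℝ) :
    (∑ x : Fin (n + 2) → α, if x 0 = a ∧ x (Fin.last (n + 1)) = b then
      wordLaw P (n + 2) v x else 0) = v a * (P ^ (n + 1)) a b := by
  induction n generalizing v a with
  | zero =>
    simp only [sum_fin_succ_arrow, wordLaw, ite_and]
    simp [Fin.last, Fin.tail]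
  | succ n ih =>
    rw [sum_fin_succ_arrow, Finset.sum_eq_single a (fun c _ hc => by simp [hc]) (by simp),
      pow_succ', Matrix.mul_apply]
    simp_rw [← ih]
    rw [Finset.sum_comm, Finset.mul_sum]
    refine Finset.sum_congr rfl fun y _ => ?_
    rw [wordLaw]
    simp only [Fin.cons_zero, Fin.tail_cons, true_and, ite_and, ← Fin.succ_last, Fin.cons_succ]
    simp

end MarkovWords

/-! ### The mutual information rate -/

section StationaryChains

variable {α : Type*} [Fintype α] [DecidableEq α] {π : α → ℝ} {P : Matrix α α ℝ}

/-- The entropy `H(X_{k+1} | X_0)` of the letter after `k + 1` steps of the Markov chain with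
transition matrix `P`, given the present letter of law `π`. -/
def stepEntropy (π : α → ℝ) (P : Matrix α α ℝ) (k : ℕ) : ℝ :=
  ∑ a, π a * vecEntropy ((P ^ (k + 1)) a)

lemma stepEntropy_nonneg (hπ : π ∈ stdSimplex ℝ α) (hP : P ∈ Matrix.rowStochastic ℝ α) (k : ℕ) :
    0 ≤ stepEntropy π P k :=
  Finset.sum_nonneg fun a _ =>
    mul_nonneg (hπ.1 a) (vecEntropy_nonneg (row_mem_stdSimplex (pow_mem hP _) a))

lemma stepEntropy_le (hπ : π ∈ stdSimplex ℝ α) (hP : P ∈ Matrix.rowStochastic ℝ α) (k : ℕ) :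
    stepEntropy π P k ≤ Fintype.card α - 1 :=
  calc stepEntropy π P k ≤ ∑ a, π a * (Fintype.card α - 1) :=
        Finset.sum_le_sum fun a _ => mul_le_mul_of_nonneg_left
          (vecEntropy_le (row_mem_stdSimplex (pow_mem hP _) a)) (hπ.1 a)
    _ = Fintype.card α - 1 := by rw [← Finset.sum_mul, hπ.2, one_mul]

lemma summable_stepEntropy (hπ : π ∈ stdSimplex ℝ α) (hP : P ∈ Matrix.rowStochastic ℝ α) {ε : ℝ}
    (hε : ε ∈ Ico (0 : ℝ) 1) : Summable fun k => ε ^ k * stepEntropy π P k :=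
  ((summable_geometric_of_lt_one hε.1 hε.2).mul_right _).of_nonneg_of_le
    (fun k => mul_nonneg (pow_nonneg hε.1 k) (stepEntropy_nonneg hπ hP k))
    (fun k => mul_le_mul_of_nonneg_left (stepEntropy_le hπ hP k) (pow_nonneg hε.1 k))

lemma sum_mul_pow_apply_mul (hst : π ᵥ* P = π) (k : ℕ) (f : α → ℝ) :
    ∑ a, π a * ∑ b, (P ^ k) a b * f b = ∑ b, π b * f b := by
  have invariant : π ᵥ* P ^ k = π := by
    induction k with
    | zero => simp
    | succ k ih => rw [pow_succ, ← Matrix.vecMul_vecMul, ih, hst]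
  have assoc := Matrix.dotProduct_mulVec π (P ^ k) f
  rwa [invariant] at assoc

/-- The average over `π` of the visible entropy of a word of `N` letters that starts `j + 1` steps
after a letter of law `π`, given that letter. -/
def delayedEntropy (ε : ℝ) (π : α → ℝ) (P : Matrix α α ℝ) (j N : ℕ) : ℝ :=
  ∑ a, π a * visibleEntropy ε (wordLaw P N ((P ^ (j + 1)) a))

lemma delayedEntropy_zero (ε : ℝ) (j : ℕ) : delayedEntropy ε π P j 0 = 0 := by
  simp [delayedEntropy, visibleEntropy_zero, wordLaw]

lemma delayedEntropy_succ (hP : P ∈ Matrix.rowStochastic ℝ α) (hst : π ᵥ* P = π) (ε : ℝ)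
    (j N : ℕ) :
    delayedEntropy ε π P j (N + 1) =
      (1 - ε) * (stepEntropy π P j + delayedEntropy ε π P 0 N) +
        ε * delayedEntropy ε π P (j + 1) N := by
  have step (a : α) : (P ^ (j + 1)) a ᵥ* P = (P ^ (j + 1 + 1)) a := by
    rw [pow_succ (n := j + 1)]
    rfl
  simp only [delayedEntropy,
    fun a => visibleEntropy_wordLaw_succ hP ε N (row_mem_stdSimplex (pow_mem hP (j + 1)) a), step,
    mul_add, Finset.sum_add_distrib, mul_left_comm (π _), ← Finset.mul_sum,
    sum_mul_pow_apply_mul hst, stepEntropy, zero_add, pow_one]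

/-- The new letter of a longer word contributes, by the chain rule, its entropy given the last
visible letter, which lies `i + 1` steps back with probability `(1 - ε) ε ^ i`. -/
lemma delayedEntropy_succ_sub (hP : P ∈ Matrix.rowStochastic ℝ α) (hst : π ᵥ* P = π) (ε : ℝ)
    (j N : ℕ) :
    delayedEntropy ε π P j (N + 1) - delayedEntropy ε π P j N =
      (1 - ε) * ((1 - ε) * ∑ i ∈ Finset.range N, ε ^ i * stepEntropy π P i +
        ε ^ N * stepEntropy π P (j + N)) := by
  induction N generalizing j with
  | zero => simp [delayedEntropy_succ hP hst, delayedEntropy_zero]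
  | succ N ih =>
    have h0 := ih 0
    rw [zero_add] at h0
    have h1 := ih (j + 1)
    rw [add_right_comm] at h1
    rw [delayedEntropy_succ hP hst ε j (N + 1), delayedEntropy_succ hP hst ε j N,
      Finset.sum_range_succ, ← add_assoc j]
    linear_combination (1 - ε) * h0 + ε * h1

lemma visibleEntropy_wordLaw_succ_sub (hπ : π ∈ stdSimplex ℝ α)
    (hP : P ∈ Matrix.rowStochastic ℝ α) (hst : π ᵥ* P = π) (ε : ℝ) (N : ℕ) :
    visibleEntropy ε (wordLaw P (N + 1) π) - visibleEntropy ε (wordLaw P N π) =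
      (1 - ε) * ((1 - ε) * ∑ i ∈ Finset.range N, ε ^ i * stepEntropy π P i +
        ε ^ N * vecEntropy π) := by
  have recursion (N : ℕ) : visibleEntropy ε (wordLaw P (N + 1) π) =
      (1 - ε) * (vecEntropy π + delayedEntropy ε π P 0 N) +
        ε * visibleEntropy ε (wordLaw P N π) := by
    simp only [visibleEntropy_wordLaw_succ hP ε N hπ, hst, delayedEntropy, zero_add, pow_one]
  induction N with
  | zero =>
    rw [recursion, delayedEntropy_zero]
    simp [visibleEntropy_zero, wordLaw]
  | succ N ih =>
    have h0 := delayedEntropy_succ_sub hP hst ε 0 N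
    rw [zero_add] at h0
    rw [Finset.sum_range_succ]
    linear_combination recursion (N + 1) - recursion N + (1 - ε) * h0 + ε * ih

lemma tendsto_div_of_tendsto_sub {f : ℕ → ℝ} {l : ℝ}
    (h : Tendsto (fun n => f (n + 1) - f n) atTop (𝓝 l)) :
    Tendsto (fun n => f n / n) atTop (𝓝 l) := by
  have mean := h.cesaro
  simp only [Finset.sum_range_sub] at mean
  have initial : Tendsto (fun n : ℕ => (n : ℝ)⁻¹ * f 0) atTop (𝓝 0) := by
    simpa using tendsto_inv_atTop_nhds_zero_nat.mul_const (f 0)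
  simpa using (mean.add initial).congr fun n => by ring

theorem tendsto_visibleEntropy_div (hπ : π ∈ stdSimplex ℝ α)
    (hP : P ∈ Matrix.rowStochastic ℝ α) (hst : π ᵥ* P = π) {ε : ℝ} (hε : ε ∈ Ico (0 : ℝ) 1) :
    Tendsto (fun N : ℕ => visibleEntropy ε (wordLaw P N π) / N) atTop
      (𝓝 ((1 - ε) ^ 2 * ∑' k, ε ^ k * stepEntropy π P k)) := by
  apply tendsto_div_of_tendsto_sub
  simp only [visibleEntropy_wordLaw_succ_sub hπ hP hst]
  have partialSums := (summable_stepEntropy hπ hP hε).hasSum.tendsto_sum_nat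
  have remainder := (tendsto_pow_atTop_nhds_zero_of_lt_one hε.1 hε.2).mul_const (vecEntropy π)
  convert ((partialSums.const_mul (1 - ε)).add remainder).const_mul (1 - ε) using 2
  ring

end StationaryChains

lemma IsStationaryChain.init_mem_stdSimplex {π : Letter → ℝ} {P : Matrix Letter Letter ℝ}
    (h : IsStationaryChain π P) : π ∈ stdSimplex ℝ Letter :=
  ⟨h.init_nonneg, h.init_sum⟩

lemma IsStationaryChain.trans_mem_rowStochastic {π : Letter → ℝ} {P : Matrix Letter Letter ℝ}
    (h : IsStationaryChain π P) : P ∈ Matrix.rowStochastic ℝ Letter :=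
  Matrix.mem_rowStochastic_iff_sum.2 ⟨h.trans_nonneg, h.trans_sum⟩

lemma blockLaw_eq_wordLaw (π : Letter → ℝ) (P : Matrix Letter Letter ℝ) (n : ℕ) :
    blockLaw π P n = wordLaw P (n + 1) π := by
  induction n generalizing π with
  | zero => funext x; simp [blockLaw, wordLaw]
  | succ n ih =>
    funext x
    rw [wordLaw, ← ih, blockLaw, blockLaw, Fin.prod_univ_succ]
    rfl

theorem tendsto_blockInfo {π : Letter → ℝ} {P : Matrix Letter Letter ℝ}
    (h : IsStationaryChain π P) {ε : ℝ} (hε : ε ∈ Ico (0 : ℝ) 1) :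
    Tendsto (blockInfo ε π P) atTop
      (𝓝 ((1 - ε) ^ 2 * ∑' k, ε ^ k * stepEntropy π P k)) := by
  have rate := tendsto_visibleEntropy_div h.init_mem_stdSimplex h.trans_mem_rowStochastic
    (funext h.stationary) hε
  refine ((tendsto_add_atTop_iff_nat 1).2 rate).congr fun n => ?_
  rw [blockInfo, mutualInfo_jointLaw, blockLaw_eq_wordLaw, Nat.cast_succ]

lemma infoRate_eq {π : Letter → ℝ} {P : Matrix Letter Letter ℝ} (h : IsStationaryChain π P)
    {ε : ℝ} (hε : ε ∈ Ico (0 : ℝ) 1) :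
    infoRate ε π P = (1 - ε) ^ 2 * ∑' k, ε ^ k * stepEntropy π P k :=
  (tendsto_blockInfo h hε).limUnder_eq

lemma pairLaw_eq (π : Letter → ℝ) (P : Matrix Letter Letter ℝ) (k : ℕ) (z : Letter × Letter) :
    pairLaw π P k z = π z.1 * (P ^ (k + 1)) z.1 z.2 := by
  rw [pairLaw, blockLaw_eq_wordLaw, sum_wordLaw_first_last]

lemma condEntropy_pairLaw {π : Letter → ℝ} {P : Matrix Letter Letter ℝ}
    (hP : P ∈ Matrix.rowStochastic ℝ Letter) (k : ℕ) :
    condEntropy (pairLaw π P k) = stepEntropy π P k := by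
  have fst (a : Letter) : fstLaw (pairLaw π P k) a = π a := by
    simp only [fstLaw, pairLaw_eq, ← Finset.mul_sum,
      Matrix.sum_row_of_mem_rowStochastic (pow_mem hP _), mul_one]
  simp only [condEntropy, stepEntropy, vecEntropy, fst, pairLaw_eq, Fintype.sum_prod_type,
    ← Finset.sum_neg_distrib, Finset.mul_sum]
  refine Finset.sum_congr rfl fun a _ => Finset.sum_congr rfl fun b _ => ?_
  rcases eq_or_ne (π a) 0 with ha | ha
  · simp [ha]
  · rw [mul_div_cancel_left₀ _ ha, Real.negMulLog]
    ring

/-! ### The chains supported on the constraint -/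

lemma wordLaw_congr_of_absorbing {P P' : Matrix Letter Letter ℝ} (hrow : P 0 = P' 0)
    (habs : P 0 1 = 0) (N : ℕ) {v : Letter → ℝ} (hv : v 1 = 0) :
    wordLaw P N v = wordLaw P' N v := by
  induction N generalizing v with
  | zero => rfl
  | succ N ih =>
    funext x
    rw [wordLaw, wordLaw]
    rcases Fin.exists_fin_two.1 ⟨x 0, rfl⟩ with hx | hx
    · rw [hx, ← hrow, ih habs]
    · rw [hx, hv, zero_mul, zero_mul]

section AdmissibleChains

variable {π : Letter → ℝ} {P : Matrix Letter Letter ℝ}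

lemma SupportedOn.init_one_mul_trans_one_one (h : IsStationaryChain π P)
    (hs : SupportedOn rllConstraint π P) : π 1 * P 1 1 = 0 := by
  by_contra hne
  have hpos : 0 < blockLaw π P 1 ![1, 1] := by
    simpa [blockLaw] using (mul_nonneg (h.init_nonneg 1) (h.trans_nonneg 1 1)).lt_of_ne' hne
  simpa [rllConstraint, List.ofFn_succ] using hs 1 ![1, 1] hpos

lemma IsStationaryChain.blockLaw_eq_rll_zero (h : IsStationaryChain π P) (h1 : π 1 = 0) (n : ℕ) :
    blockLaw π P n = blockLaw (rllInit 0) (rllTrans 0) n := by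
  have hsum := h.init_sum
  have hrow := h.trans_sum 0
  have hst := h.stationary 1
  rw [Fin.sum_univ_two] at hsum hrow hst
  have hπ0 : π 0 = 1 := by linarith
  have hP01 : P 0 1 = 0 := by rw [h1, hπ0] at hst; linarith
  have hP00 : P 0 0 = 1 := by linarith
  have hπ : π = rllInit 0 := by
    funext a
    fin_cases a <;> simp [rllInit, hπ0, h1]
  have hP : P 0 = rllTrans 0 0 := by
    funext b
    fin_cases b <;> simp [rllTrans, hP00, hP01]
  rw [blockLaw_eq_wordLaw, blockLaw_eq_wordLaw, ← hπ, wordLaw_congr_of_absorbing hP hP01 _ h1]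

lemma IsStationaryChain.trans_eq_rllTrans (h : IsStationaryChain π P) (h1 : P 1 1 = 0) :
    P = rllTrans (P 0 1) := by
  have hrow0 := h.trans_sum 0
  have hrow1 := h.trans_sum 1
  rw [Fin.sum_univ_two] at hrow0 hrow1
  have hP00 : P 0 0 = 1 - P 0 1 := by linarith
  have hP10 : P 1 0 = 1 := by linarith
  ext a b
  fin_cases a <;> fin_cases b <;> simp [rllTrans, hP00, hP10, h1]

lemma IsStationaryChain.init_eq_rllInit (h : IsStationaryChain π P) (h1 : P 1 1 = 0) :
    π = rllInit (P 0 1) := by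
  have hsum := h.init_sum
  have hst := h.stationary 1
  rw [Fin.sum_univ_two] at hsum hst
  have hne : 1 + P 0 1 ≠ 0 := by linarith [h.trans_nonneg 0 1]
  have hπ0 : π 0 = 1 / (1 + P 0 1) := by
    rw [eq_div_iff hne]
    rw [h1] at hst
    linarith
  have hπ1 : π 1 = P 0 1 / (1 + P 0 1) := by
    rw [← hst, h1, hπ0]
    ring
  funext a
  fin_cases a
  exacts [hπ0, hπ1]

lemma exists_blockLaw_eq_rll (h : IsStationaryChain π P) (hs : SupportedOn rllConstraint π P) :
    ∃ θ ∈ Icc (0 : ℝ) 1, ∀ n, blockLaw π P n = blockLaw (rllInit θ) (rllTrans θ) n := by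
  rcases mul_eq_zero.1 (hs.init_one_mul_trans_one_one h) with h1 | h1
  · exact ⟨0, by simp, h.blockLaw_eq_rll_zero h1⟩
  · refine ⟨P 0 1, ⟨h.trans_nonneg 0 1,
      Matrix.le_one_of_mem_rowStochastic h.trans_mem_rowStochastic⟩, fun n => ?_⟩
    rw [← h.trans_eq_rllTrans h1, ← h.init_eq_rllInit h1]

end AdmissibleChains

lemma exists_consecutive_of_pair_infix_ofFn {α : Type*} {a b : α} {n : ℕ} {x : Fin (n + 1) → α}
    (h : [a, b] <:+: List.ofFn x) : ∃ i : Fin n, x i.castSucc = a ∧ x i.succ = b := by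
  obtain ⟨s, t, hst⟩ := h
  have hlen := congrArg List.length hst
  simp only [List.length_append, List.length_cons, List.length_nil, List.length_ofFn] at hlen
  have letter (m : ℕ) (hm : m < 2) : x ⟨s.length + m, by omega⟩ = [a, b][m] := by
    have hget : (List.ofFn x)[s.length + m]? = some [a, b][m] := by
      rw [← hst, List.append_assoc, List.getElem?_append_right (Nat.le_add_right _ _),
        Nat.add_sub_cancel_left, List.getElem?_append_left hm, List.getElem?_eq_getElem]
    rw [List.getElem?_ofFn, dif_pos (by omega)] at hget
    exact Option.some.inj hget
  exact ⟨⟨s.length, by omega⟩, letter 0 (by omega), letter 1 (by omega)⟩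

lemma supportedOn_rll (θ : ℝ) : SupportedOn rllConstraint (rllInit θ) (rllTrans θ) := by
  intro n x hx hmem
  obtain ⟨i, hi, hi'⟩ := exists_consecutive_of_pair_infix_ofFn hmem
  have factor : rllTrans θ (x i.castSucc) (x i.succ) = 0 := by
    rw [hi, hi']
    simp [rllTrans]
  rw [blockLaw, Finset.prod_eq_zero (Finset.mem_univ i) factor, mul_zero] at hx
  exact hx.false

theorem markovRates_eq (ε : ℝ) : markovRates ε = rllRate ε '' Icc 0 1 := by
  ext r
  constructor
  · rintro ⟨π, P, h, hs, rfl⟩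
    obtain ⟨θ, hθ, hb⟩ := exists_blockLaw_eq_rll h hs
    refine ⟨θ, hθ, ?_⟩
    simp only [rllRate, infoRate, funext fun n => show blockInfo ε π P n = _ by
      rw [blockInfo, hb, ← blockInfo]]
  · rintro ⟨θ, hθ, rfl⟩
    exact ⟨_, _, isStationaryChain_rll hθ, supportedOn_rll θ, rfl⟩

/-! ### The entropies of the one-parameter family -/

lemma rllCondEntropy_eq_stepEntropy {θ : ℝ} (hθ : θ ∈ Icc (0 : ℝ) 1) (k : ℕ) :
    rllCondEntropy k θ = stepEntropy (rllInit θ) (rllTrans θ) k :=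
  condEntropy_pairLaw (isStationaryChain_rll hθ).trans_mem_rowStochastic k

lemma rllRate_eq {ε θ : ℝ} (hε : ε ∈ Ico (0 : ℝ) 1) (hθ : θ ∈ Icc (0 : ℝ) 1) :
    rllRate ε θ = (1 - ε) ^ 2 * ∑' k, ε ^ k * rllCondEntropy k θ := by
  simp only [rllRate, infoRate_eq (isStationaryChain_rll hθ) hε, rllCondEntropy_eq_stepEntropy hθ]

lemma rllCondEntropy_nonneg {θ : ℝ} (hθ : θ ∈ Icc (0 : ℝ) 1) (k : ℕ) : 0 ≤ rllCondEntropy k θ := by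
  have chain := isStationaryChain_rll hθ
  rw [rllCondEntropy_eq_stepEntropy hθ]
  exact stepEntropy_nonneg chain.init_mem_stdSimplex chain.trans_mem_rowStochastic k

lemma rllCondEntropy_le_one {θ : ℝ} (hθ : θ ∈ Icc (0 : ℝ) 1) (k : ℕ) : rllCondEntropy k θ ≤ 1 := by
  have chain := isStationaryChain_rll hθ
  rw [rllCondEntropy_eq_stepEntropy hθ]
  refine (stepEntropy_le chain.init_mem_stdSimplex chain.trans_mem_rowStochastic k).trans ?_
  norm_num

lemma stepEntropy_eq_sub {α : Type*} [Fintype α] [DecidableEq α] {P : Matrix α α ℝ}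
    (hP : P ∈ Matrix.rowStochastic ℝ α) (π : α → ℝ) (k : ℕ) :
    stepEntropy π P k =
      ∑ a, ∑ b, Real.negMulLog (π a * (P ^ (k + 1)) a b) - vecEntropy π := by
  simp only [stepEntropy, vecEntropy, Real.negMulLog_mul, Finset.sum_add_distrib,
    ← Finset.sum_mul, ← Finset.mul_sum, Matrix.sum_row_of_mem_rowStochastic (pow_mem hP _),
    one_mul, add_sub_cancel_left]

lemma rllTrans_pow {θ : ℝ} (hθ : 1 + θ ≠ 0) (n : ℕ) :
    rllTrans θ ^ n = !![(1 + θ * (-θ) ^ n) / (1 + θ), θ * (1 - (-θ) ^ n) / (1 + θ);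
      (1 - (-θ) ^ n) / (1 + θ), (θ + (-θ) ^ n) / (1 + θ)] := by
  induction n with
  | zero =>
    ext a b
    fin_cases a <;> fin_cases b <;> simp [hθ, add_comm θ 1]
  | succ n ih =>
    rw [pow_succ, ih, rllTrans, Matrix.mul_fin_two]
    congrm !![?_, ?_; ?_, ?_] <;> field_simp <;> ring

/-- The entropy of a letter given another one, for a pair of two-valued letters which take the
second value with probability `t` each and have the covariance `c`. -/
def pairEntropy (t c : ℝ) : ℝ :=
  Real.negMulLog ((1 - t) ^ 2 + c) + 2 * Real.negMulLog (t * (1 - t) - c) +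
    Real.negMulLog (t ^ 2 + c) - (Real.negMulLog (1 - t) + Real.negMulLog t)

/-- The covariance of two letters at distance `k + 1` in the chain of parameter `θ`, in terms of
`t = θ / (1 + θ)`. -/
def lagCov (k : ℕ) (t : ℝ) : ℝ := -(-1) ^ k * (t ^ (k + 2) / (1 - t) ^ k)

lemma lagCov_div {θ : ℝ} (hθ : 1 + θ ≠ 0) (k : ℕ) :
    lagCov k (θ / (1 + θ)) = -(-θ) ^ k * (θ / (1 + θ)) ^ 2 := by
  have : 1 - θ / (1 + θ) = (1 + θ)⁻¹ := by field_simp; ring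
  rw [lagCov, this, neg_pow θ k, pow_add, div_pow θ _ k, inv_pow]
  field_simp

/-- The probability `t` of the letter `2` is the parameter in which the entropies are concave. -/
lemma rllCondEntropy_eq_pairEntropy {θ : ℝ} (hθ : θ ∈ Icc (0 : ℝ) 1) (k : ℕ) :
    rllCondEntropy k θ = pairEntropy (θ / (1 + θ)) (lagCov k (θ / (1 + θ))) := by
  have hs : 1 + θ ≠ 0 := by linarith [hθ.1]
  rw [rllCondEntropy_eq_stepEntropy hθ, lagCov_div hs,
    stepEntropy_eq_sub (isStationaryChain_rll hθ).trans_mem_rowStochastic, rllTrans_pow hs]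
  simp only [vecEntropy, rllInit, Fin.sum_univ_two, Matrix.of_apply, Matrix.cons_val_zero,
    Matrix.cons_val_one, pairEntropy]
  have p00 : 1 / (1 + θ) * ((1 + θ * (-θ) ^ (k + 1)) / (1 + θ)) =
      (1 - θ / (1 + θ)) ^ 2 + -(-θ) ^ k * (θ / (1 + θ)) ^ 2 := by field_simp; ring
  have p01 : 1 / (1 + θ) * (θ * (1 - (-θ) ^ (k + 1)) / (1 + θ)) =
      θ / (1 + θ) * (1 - θ / (1 + θ)) - -(-θ) ^ k * (θ / (1 + θ)) ^ 2 := by field_simp; ring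
  have p10 : θ / (1 + θ) * ((1 - (-θ) ^ (k + 1)) / (1 + θ)) =
      θ / (1 + θ) * (1 - θ / (1 + θ)) - -(-θ) ^ k * (θ / (1 + θ)) ^ 2 := by field_simp; ring
  have p11 : θ / (1 + θ) * ((θ + (-θ) ^ (k + 1)) / (1 + θ)) =
      (θ / (1 + θ)) ^ 2 + -(-θ) ^ k * (θ / (1 + θ)) ^ 2 := by field_simp; ring
  have p0 : 1 / (1 + θ) = 1 - θ / (1 + θ) := by field_simp; ring
  rw [p00, p01, p10, p11, p0]
  ring

lemma rllCondEntropy_zero (k : ℕ) : rllCondEntropy k 0 = 0 := by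
  rw [rllCondEntropy_eq_pairEntropy (by simp)]
  simp [pairEntropy, lagCov]

lemma rllCondEntropy_one (k : ℕ) : rllCondEntropy k 1 = 0 := by
  rw [rllCondEntropy_eq_pairEntropy (by simp), lagCov_div (by norm_num), pairEntropy]
  rcases neg_one_pow_eq_or ℝ k with h | h <;> rw [h] <;> norm_num [two_mul]

lemma continuousOn_rllCondEntropy (k : ℕ) : ContinuousOn (rllCondEntropy k) (Icc 0 1) := by
  have hs : ∀ θ ∈ Icc (0 : ℝ) 1, 1 + θ ≠ 0 := fun θ hθ => by linarith [hθ.1]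
  have : ContinuousOn (fun θ : ℝ => θ / (1 + θ)) (Icc 0 1) :=
    continuousOn_id.div (by fun_prop) hs
  refine ContinuousOn.congr (f := fun θ => pairEntropy (θ / (1 + θ))
    (-(-θ) ^ k * (θ / (1 + θ)) ^ 2)) ?_ fun θ hθ => ?_
  · simp only [pairEntropy]
    fun_prop
  · rw [rllCondEntropy_eq_pairEntropy hθ, lagCov_div (hs θ hθ)]

/-! ### Concavity -/

section Concavity

variable {t c c' c'' : ℝ}

/-- The derivative of `pairEntropy` along a curve of pairs `(t, c)`, where `c'` is the derivative of
the covariance. -/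
def pairSlope (t c c' : ℝ) : ℝ :=
  (2 * (1 - t) - c') * Real.log ((1 - t) ^ 2 + c)
    - 2 * (1 - 2 * t - c') * Real.log (t * (1 - t) - c)
    - (2 * t + c') * Real.log (t ^ 2 + c) + Real.log t - Real.log (1 - t)

/-- The logarithm of the odds ratio of the pair of letters that `pairEntropy t c` is about. -/
def pairLogOdds (t c : ℝ) : ℝ :=
  Real.log ((1 - t) ^ 2 + c) + Real.log (t ^ 2 + c) - 2 * Real.log (t * (1 - t) - c)

/-- The second derivative of `pairEntropy` along a curve of pairs `(t, c)`, where `c'` and `c''` are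
the derivatives of the covariance. -/
def pairCurvature (t c c' c'' : ℝ) : ℝ :=
  1 / t + 1 / (1 - t) - (2 + c'') * pairLogOdds t c
    - (((c' - 2 * (1 - t)) ^ 2 / ((1 - t) ^ 2 + c)
        + (1 - 2 * t - c') ^ 2 / (t * (1 - t) - c))
      + ((1 - 2 * t - c') ^ 2 / (t * (1 - t) - c) + (2 * t + c') ^ 2 / (t ^ 2 + c)))

lemma hasDerivAt_negMulLog_comp {p : ℝ → ℝ} {p' : ℝ} (hp : HasDerivAt p p' t) (h : p t ≠ 0) :
    HasDerivAt (fun s => Real.negMulLog (p s)) (-p' * Real.log (p t) - p') t := by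
  refine ((Real.hasDerivAt_negMulLog h).comp t hp).congr_deriv ?_
  ring

section Curve

variable {γ : ℝ → ℝ}

lemma hasDerivAt_probZeroZero (hγ : HasDerivAt γ c' t) :
    HasDerivAt (fun s => (1 - s) ^ 2 + γ s) (c' - 2 * (1 - t)) t :=
  ((((hasDerivAt_id t).const_sub 1).pow 2).add hγ).congr_deriv (by
    simp only [Nat.cast_ofNat, id_eq, Nat.add_one_sub_one, pow_one]
    ring)

lemma hasDerivAt_probZeroOne (hγ : HasDerivAt γ c' t) :
    HasDerivAt (fun s => s * (1 - s) - γ s) (1 - 2 * t - c') t :=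
  (((hasDerivAt_id t).mul ((hasDerivAt_id t).const_sub 1)).sub hγ).congr_deriv (by
    simp only [id_eq]
    ring)

lemma hasDerivAt_probOneOne (hγ : HasDerivAt γ c' t) :
    HasDerivAt (fun s => s ^ 2 + γ s) (2 * t + c') t :=
  (((hasDerivAt_id t).pow 2).add hγ).congr_deriv (by simp)

lemma hasDerivAt_pairEntropy (ht : t ∈ Ioo (0 : ℝ) 1) (h00 : (1 - t) ^ 2 + γ t ≠ 0)
    (h01 : t * (1 - t) - γ t ≠ 0) (h11 : t ^ 2 + γ t ≠ 0) (hγ : HasDerivAt γ c' t) :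
    HasDerivAt (fun s => pairEntropy s (γ s)) (pairSlope t (γ t) c') t := by
  have d0 := hasDerivAt_negMulLog_comp ((hasDerivAt_id t).const_sub 1) (sub_pos.2 ht.2).ne'
  have d1 := hasDerivAt_negMulLog_comp (hasDerivAt_id t) ht.1.ne'
  refine ((((hasDerivAt_negMulLog_comp (hasDerivAt_probZeroZero hγ) h00).add
    ((hasDerivAt_negMulLog_comp (hasDerivAt_probZeroOne hγ) h01).const_mul 2)).add
    (hasDerivAt_negMulLog_comp (hasDerivAt_probOneOne hγ) h11)).sub (d0.add d1)).congr_deriv ?_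
  simp only [pairSlope, id]
  ring

lemma hasDerivAt_pairSlope {γ' : ℝ → ℝ} (ht : t ∈ Ioo (0 : ℝ) 1)
    (h00 : (1 - t) ^ 2 + γ t ≠ 0) (h01 : t * (1 - t) - γ t ≠ 0) (h11 : t ^ 2 + γ t ≠ 0)
    (hγ : HasDerivAt γ (γ' t) t) (hγ' : HasDerivAt γ' c'' t) :
    HasDerivAt (fun s => pairSlope s (γ s) (γ' s)) (pairCurvature t (γ t) (γ' t) c'') t := by
  have ht0 := ht.1.ne'
  have ht1 := (sub_pos.2 ht.2).ne'
  have dt := hasDerivAt_id t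
  have dt' := dt.const_sub 1
  have d00 := ((dt'.const_mul 2).sub hγ').mul ((hasDerivAt_probZeroZero hγ).log h00)
  have d01 := (((dt.const_mul 2).const_sub 1).sub hγ').const_mul 2 |>.mul
    ((hasDerivAt_probZeroOne hγ).log h01)
  have d11 := ((dt.const_mul 2).add hγ').mul ((hasDerivAt_probOneOne hγ).log h11)
  refine ((((d00.sub d01).sub d11).add (dt.log ht0)).sub (dt'.log ht1)).congr_deriv ?_
  simp only [pairCurvature, pairLogOdds, id, Pi.add_apply, Pi.sub_apply]
  field_simp
  ring

end Curve

lemma sq_div_add_sq_div {x y : ℝ} (hx : x ≠ 0) (hy : y ≠ 0) (hxy : x + y ≠ 0) (a b : ℝ) :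
    a ^ 2 / x + b ^ 2 / y =
      (a + b) ^ 2 / (x + y) + (a * y - b * x) ^ 2 / (x * y * (x + y)) := by
  field_simp
  ring

lemma add_sq_div_le {x y : ℝ} (hx : 0 < x) (hy : 0 < y) (a b : ℝ) :
    (a + b) ^ 2 / (x + y) ≤ a ^ 2 / x + b ^ 2 / y := by
  rw [sq_div_add_sq_div hx.ne' hy.ne' (add_pos hx hy).ne']
  exact le_add_of_nonneg_right (by positivity)

lemma pairLogOdds_eq_log (h00 : (1 - t) ^ 2 + c ≠ 0) (h01 : t * (1 - t) - c ≠ 0)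
    (h11 : t ^ 2 + c ≠ 0) : pairLogOdds t c =
      Real.log (((1 - t) ^ 2 + c) * (t ^ 2 + c) / (t * (1 - t) - c) ^ 2) := by
  rw [Real.log_div (mul_ne_zero h00 h11) (pow_ne_zero 2 h01), Real.log_mul h00 h11, Real.log_pow,
    pairLogOdds]
  norm_cast

lemma prob_mul_prob_sub_sq (t c : ℝ) :
    ((1 - t) ^ 2 + c) * (t ^ 2 + c) - (t * (1 - t) - c) ^ 2 = c := by
  ring

lemma pairLogOdds_nonneg (h00 : 0 < (1 - t) ^ 2 + c) (h01 : 0 < t * (1 - t) - c)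
    (h11 : 0 < t ^ 2 + c) (hc : 0 ≤ c) : 0 ≤ pairLogOdds t c := by
  rw [pairLogOdds_eq_log h00.ne' h01.ne' h11.ne']
  refine Real.log_nonneg ((one_le_div (by positivity)).2 ?_)
  rwa [← sub_nonneg, prob_mul_prob_sub_sq]

lemma pairLogOdds_nonpos (h00 : 0 < (1 - t) ^ 2 + c) (h01 : 0 < t * (1 - t) - c)
    (h11 : 0 < t ^ 2 + c) (hc : c ≤ 0) : pairLogOdds t c ≤ 0 := by
  rw [pairLogOdds_eq_log h00.ne' h01.ne' h11.ne']
  refine Real.log_nonpos (by positivity) ((div_le_one (by positivity)).2 ?_)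
  rwa [← sub_nonpos, prob_mul_prob_sub_sq]

lemma neg_pairLogOdds_le (h00 : 0 < (1 - t) ^ 2 + c) (h01 : 0 < t * (1 - t) - c)
    (h11 : 0 < t ^ 2 + c) :
    -pairLogOdds t c ≤ -c / (((1 - t) ^ 2 + c) * (t ^ 2 + c)) := by
  rw [pairLogOdds_eq_log h00.ne' h01.ne' h11.ne', ← Real.log_inv, inv_div]
  refine (Real.log_le_sub_one_of_pos (by positivity)).trans_eq ?_
  rw [div_sub_one (by positivity)]
  congr 1
  rw [← neg_sub, prob_mul_prob_sub_sq]

lemma one_div_one_sub_le_row_zero (ht : t < 1) (h00 : 0 < (1 - t) ^ 2 + c)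
    (h01 : 0 < t * (1 - t) - c) :
    1 / (1 - t) ≤ (c' - 2 * (1 - t)) ^ 2 / ((1 - t) ^ 2 + c)
      + (1 - 2 * t - c') ^ 2 / (t * (1 - t) - c) := by
  refine le_of_eq_of_le ?_ (add_sq_div_le h00 h01 _ _)
  have : 1 - t ≠ 0 := (sub_pos.2 ht).ne'
  ring_nf

lemma one_div_le_row_one (h01 : 0 < t * (1 - t) - c) (h11 : 0 < t ^ 2 + c) :
    1 / t ≤ (1 - 2 * t - c') ^ 2 / (t * (1 - t) - c) + (2 * t + c') ^ 2 / (t ^ 2 + c) := by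
  refine le_of_eq_of_le ?_ (add_sq_div_le h01 h11 _ _)
  ring_nf

lemma pairCurvature_nonpos_of_cov_nonneg (ht : t ∈ Ioo (0 : ℝ) 1) (hc : 0 ≤ c)
    (h01 : 0 < t * (1 - t) - c) (hc'' : 0 ≤ c'') : pairCurvature t c c' c'' ≤ 0 := by
  have ht0 := ht.1
  have ht1 := sub_pos.2 ht.2
  have h00 : 0 < (1 - t) ^ 2 + c := by positivity
  have h11 : 0 < t ^ 2 + c := by positivity
  have odds : 0 ≤ (2 + c'') * pairLogOdds t c :=
    mul_nonneg (by positivity) (pairLogOdds_nonneg h00 h01 h11 hc)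
  have row0 := one_div_one_sub_le_row_zero (c' := c') ht.2 h00 h01
  have row1 := one_div_le_row_one (c' := c') h01 h11
  rw [pairCurvature]
  linarith

lemma curvature_row_zero_ge (ht : t ∈ Ioo (0 : ℝ) (1 / 2)) (hc : c < 0) (hct : -c ≤ t ^ 2 / 6)
    (hc' : c' ≤ 0) :
    1 / (1 - t) + 12 / 7 ≤ (c' - 2 * (1 - t)) ^ 2 / ((1 - t) ^ 2 + c)
      + (1 - 2 * t - c') ^ 2 / (t * (1 - t) - c) := by
  obtain ⟨ht0, ht1⟩ := ht
  have h00 : 0 < (1 - t) ^ 2 + c := by nlinarith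
  have h01 : 0 < t * (1 - t) - c := by nlinarith
  have hb : 0 < 1 - t := by linarith
  have hsum : (1 - t) ^ 2 + c + (t * (1 - t) - c) = 1 - t := by ring
  rw [sq_div_add_sq_div h00.ne' h01.ne' (by rw [hsum]; exact hb.ne'), hsum]
  refine add_le_add (by ring_nf; rfl) ((div_le_div_iff₀ (by norm_num) (by positivity)).2 ?_)
  have cross : (c' - 2 * (1 - t)) * (t * (1 - t) - c) - (1 - 2 * t - c') * ((1 - t) ^ 2 + c) =
      -((1 - t) ^ 2 + (-c' * (1 - t) + -c)) := by ring
  have cross_sq : ((1 - t) ^ 2) ^ 2 ≤ ((1 - t) ^ 2 + (-c' * (1 - t) + -c)) ^ 2 := by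
    have : 0 ≤ -c' * (1 - t) + -c := by nlinarith
    gcongr
    linarith
  have prob_le : ((1 - t) ^ 2 + c) * (t * (1 - t) - c) ≤ (1 - t) ^ 2 * (7 / 12 * (1 - t)) := by
    gcongr
    · linarith
    · nlinarith
  rw [cross, neg_sq]
  nlinarith [mul_le_mul_of_nonneg_right prob_le hb.le]

lemma pairLogOdds_term_le (ht : t ∈ Ioo (0 : ℝ) (1 / 2)) (hc : c < 0) (hct : -c ≤ t ^ 2 / 6)
    (hc'' : c'' ∈ Icc (-2) (12 * c / t ^ 2)) : -((2 + c'') * pairLogOdds t c) ≤ 12 / 25 := by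
  obtain ⟨ht0, ht1⟩ := ht
  have : 0 < 1 - t := by linarith
  obtain ⟨v, rfl⟩ : ∃ v, c = -(v * t ^ 2) := ⟨-c / t ^ 2, by field_simp⟩
  have hv : 0 < v := by
    by_contra! hv
    nlinarith [mul_nonneg (neg_nonneg.2 hv) (sq_nonneg t)]
  have : v ≤ 1 / 6 := by
    by_contra! hv'
    nlinarith [mul_lt_mul_of_pos_right hv' (pow_pos ht0 2)]
  have h00 : 5 / 6 * (1 / 2) ^ 2 ≤ (1 - t) ^ 2 + -(v * t ^ 2) := by nlinarith
  have h11 : 5 / 6 * t ^ 2 ≤ t ^ 2 + -(v * t ^ 2) := by nlinarith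
  have odds : -pairLogOdds t (-(v * t ^ 2)) ≤ 144 / 25 * v := by
    refine (neg_pairLogOdds_le (by linarith) (by nlinarith) (by nlinarith [pow_pos ht0 2])).trans ?_
    rw [neg_neg]
    calc v * t ^ 2 / (((1 - t) ^ 2 + -(v * t ^ 2)) * (t ^ 2 + -(v * t ^ 2)))
        ≤ v * t ^ 2 / (5 / 6 * (1 / 2) ^ 2 * (5 / 6 * t ^ 2)) := by gcongr
      _ = 144 / 25 * v := by
        field_simp
        norm_num
  have weight : 2 + c'' ≤ 2 - 12 * v := by
    have := hc''.2
    rw [show 12 * -(v * t ^ 2) / t ^ 2 = -(12 * v) by field_simp] at this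
    linarith
  have weight_nonneg : 0 ≤ 2 + c'' := by linarith [hc''.1]
  calc -((2 + c'') * pairLogOdds t (-(v * t ^ 2)))
      = (2 + c'') * -pairLogOdds t (-(v * t ^ 2)) := by ring
    _ ≤ (2 + c'') * (144 / 25 * v) := mul_le_mul_of_nonneg_left odds weight_nonneg
    _ ≤ (2 - 12 * v) * (144 / 25 * v) := by gcongr
    _ ≤ 12 / 25 := by nlinarith [sq_nonneg (v - 1 / 12)]

lemma pairCurvature_nonpos_of_cov_neg (ht : t ∈ Ioo (0 : ℝ) (1 / 2)) (hc : c < 0)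
    (h11 : 0 < t ^ 2 + c) (hc' : c' ≤ 0) (hc'' : c'' ≤ 12 * c / t ^ 2) :
    pairCurvature t c c' c'' ≤ 0 := by
  have ht0 := ht.1
  have ht1 := ht.2
  have h00 : 0 < (1 - t) ^ 2 + c := by nlinarith
  have h01 : 0 < t * (1 - t) - c := by nlinarith
  have row1 := one_div_le_row_one (c' := c') h01 h11
  rw [pairCurvature]
  rcases le_total 0 (2 + c'') with h | h
  · have hct : -c ≤ t ^ 2 / 6 := by
      rw [le_div_iff₀ (by positivity)] at hc''
      nlinarith [sq_nonneg t]
    have row0 := curvature_row_zero_ge ht hc hct hc'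
    have odds := pairLogOdds_term_le ht hc hct ⟨by linarith, hc''⟩
    linarith
  · have row0 := one_div_one_sub_le_row_zero (c' := c') (by linarith) h00 h01
    have odds := mul_nonneg_of_nonpos_of_nonpos h (pairLogOdds_nonpos h00 h01 h11 hc.le)
    linarith

end Concavity

section LagConcavity

variable {k : ℕ} {t : ℝ}

/-- The logarithmic derivative of `lagCov k`. -/
def lagRate (k : ℕ) (t : ℝ) : ℝ := (k + 2) / t + k / (1 - t)

/-- The second derivative of `lagCov k` divided by `lagCov k`. -/
def lagCurvature (k : ℕ) (t : ℝ) : ℝ :=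
  (k + 1) * (k + 2) / t ^ 2 + 2 * k * (k + 2) / (t * (1 - t)) + k * (k + 1) / (1 - t) ^ 2

lemma hasDerivAt_lagCov (ht : t ∈ Ioo (0 : ℝ) 1) :
    HasDerivAt (lagCov k) (lagCov k t * lagRate k t) t := by
  have ht0 := ht.1.ne'
  have ht1 := (sub_pos.2 ht.2).ne'
  have dt := hasDerivAt_id t
  refine (((dt.pow (k + 2)).div ((dt.const_sub 1).pow k) (pow_ne_zero k ht1)).const_mul
    (-(-1) ^ k)).congr_deriv ?_
  rcases k with _ | k
  · simp only [lagCov, lagRate, pow_zero, Nat.cast_zero, zero_div, add_zero, zero_add, zero_mul,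
      mul_zero, sub_zero, div_one, one_pow, mul_one, id_eq, Pi.pow_apply, Nat.cast_ofNat]
    field_simp
    ring
  · simp only [lagCov, lagRate, Nat.cast_add, Nat.cast_one, Nat.cast_ofNat, id_eq,
      Nat.add_one_sub_one, mul_one, Pi.pow_apply, add_tsub_cancel_right]
    field_simp
    ring

lemma hasDerivAt_lagRate (ht : t ∈ Ioo (0 : ℝ) 1) :
    HasDerivAt (lagRate k) (lagCurvature k t - lagRate k t ^ 2) t := by
  have ht0 := ht.1.ne'
  have ht1 := (sub_pos.2 ht.2).ne'
  have dt := hasDerivAt_id t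
  refine (((hasDerivAt_const t ((k : ℝ) + 2)).div dt ht0).add
    ((hasDerivAt_const t (k : ℝ)).div (dt.const_sub 1) ht1)).congr_deriv ?_
  simp only [lagCurvature, lagRate, id]
  field_simp
  ring

lemma hasDerivAt_lagCov_mul_lagRate (ht : t ∈ Ioo (0 : ℝ) 1) :
    HasDerivAt (fun s => lagCov k s * lagRate k s) (lagCov k t * lagCurvature k t) t :=
  ((hasDerivAt_lagCov ht).mul (hasDerivAt_lagRate ht)).congr_deriv (by ring)

lemma lagCov_eq (k : ℕ) (t : ℝ) : lagCov k t = -(-1) ^ k * (t ^ 2 * (t / (1 - t)) ^ k) := by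
  rw [lagCov, div_pow]
  ring

lemma abs_lagCov_lt (ht : t ∈ Ioo (0 : ℝ) (1 / 2)) (hk : k ≠ 0) : |lagCov k t| < t ^ 2 := by
  obtain ⟨ht0, ht1⟩ := ht
  have hb : 0 < 1 - t := by linarith
  have ratio : 0 ≤ t / (1 - t) := by positivity
  have ratio_lt : (t / (1 - t)) ^ k < 1 :=
    pow_lt_one₀ ratio ((div_lt_one hb).2 (by linarith)) hk
  rw [lagCov_eq, abs_mul, abs_neg, abs_neg_one_pow, one_mul, abs_of_nonneg (by positivity)]
  exact mul_lt_of_lt_one_right (by positivity) ratio_lt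

lemma lagRate_nonneg (ht : t ∈ Ioo (0 : ℝ) 1) : 0 ≤ lagRate k t := by
  have ht0 := ht.1
  have ht1 := sub_pos.2 ht.2
  rw [lagRate]
  positivity

lemma lagCurvature_ge (ht : t ∈ Ioo (0 : ℝ) 1) :
    (k + 1) * (k + 2) / t ^ 2 ≤ lagCurvature k t := by
  have ht0 := ht.1
  have ht1 := sub_pos.2 ht.2
  rw [lagCurvature, add_assoc]
  exact le_add_of_nonneg_right (by positivity)

lemma pairCurvature_lagCov_nonpos (ht : t ∈ Ioo (0 : ℝ) (1 / 2)) (hk : k ≠ 0) :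
    pairCurvature t (lagCov k t) (lagCov k t * lagRate k t)
      (lagCov k t * lagCurvature k t) ≤ 0 := by
  have ht' : t ∈ Ioo (0 : ℝ) 1 := ⟨ht.1, by linarith [ht.2]⟩
  have ht0 := ht.1
  have hb : 0 < 1 - t := by linarith [ht.2]
  have cov_lt := abs_lt.1 (abs_lagCov_lt ht hk)
  have curvature := lagCurvature_ge (k := k) ht'
  have size : 0 < t ^ 2 * (t / (1 - t)) ^ k := by positivity
  rcases Nat.even_or_odd k with even | odd
  · have cov_neg : lagCov k t < 0 := by simpa [lagCov_eq, even.neg_one_pow] using size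
    refine pairCurvature_nonpos_of_cov_neg ht cov_neg (by linarith)
      (mul_nonpos_of_nonpos_of_nonneg cov_neg.le (lagRate_nonneg ht')) ?_
    have two_le : (2 : ℝ) ≤ k := by
      exact_mod_cast (Nat.two_le_iff k).2 ⟨hk, fun h => by simp [h] at even⟩
    rw [mul_comm 12, mul_div_assoc]
    refine mul_le_mul_of_nonpos_left (le_trans ?_ curvature) cov_neg.le
    gcongr
    nlinarith
  · have cov_nonneg : 0 ≤ lagCov k t := by simpa [lagCov_eq, odd.neg_one_pow] using size.le
    exact pairCurvature_nonpos_of_cov_nonneg ht' cov_nonneg (by nlinarith [ht.2])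
      (mul_nonneg cov_nonneg (le_trans (by positivity) curvature))

end LagConcavity

lemma hasDerivAt_div_one_add {θ : ℝ} (hθ : 1 + θ ≠ 0) :
    HasDerivAt (fun s : ℝ => s / (1 + s)) (1 / (1 + θ) ^ 2) θ :=
  ((hasDerivAt_id θ).div ((hasDerivAt_id θ).const_add 1) hθ).congr_deriv (by simp)

/-- The left-hand side has the sign of the second derivative of `H` with respect to
`t = θ / (1 + θ)`. -/
lemma two_mul_deriv_add_mul_deriv_deriv_of_comp_div {H g g' : ℝ → ℝ} {θ g'' : ℝ}
    (hθ : 1 + θ ≠ 0) (hH : H =ᶠ[𝓝 θ] fun s => g (s / (1 + s)))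
    (hg : ∀ᶠ t in 𝓝 (θ / (1 + θ)), HasDerivAt g (g' t) t)
    (hg' : HasDerivAt g' g'' (θ / (1 + θ))) :
    2 * deriv H θ + (1 + θ) * deriv (deriv H) θ = g'' / (1 + θ) ^ 3 := by
  have dt := hasDerivAt_div_one_add hθ
  have first : deriv H =ᶠ[𝓝 θ] fun s => g' (s / (1 + s)) * (1 / (1 + s) ^ 2) := by
    have hs : ∀ᶠ s : ℝ in 𝓝 θ, 1 + s ≠ 0 := by
      have : ContinuousAt (fun s : ℝ => 1 + s) θ := by fun_prop
      exact this.eventually_ne hθ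
    filter_upwards [hH.eventuallyEq_nhds, dt.continuousAt.eventually hg, hs] with s hHs hgs hs
    rw [hHs.deriv_eq]
    exact (hgs.comp s (hasDerivAt_div_one_add hs)).deriv
  have second : HasDerivAt (fun s => g' (s / (1 + s)) * (1 / (1 + s) ^ 2))
      (g'' / (1 + θ) ^ 4 - 2 * g' (θ / (1 + θ)) / (1 + θ) ^ 3) θ := by
    have ds := (((hasDerivAt_id θ).const_add 1).pow 2).inv (pow_ne_zero 2 hθ)
    simp only [one_div]
    refine ((hg'.comp θ dt).mul ds).congr_deriv ?_
    simp only [Function.comp_apply, id, Pi.inv_apply, Pi.pow_apply]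
    field_simp
    ring
  rw [first.deriv_eq, first.eq_of_nhds, second.deriv]
  field_simp
  ring

lemma rllCondEntropy_eventuallyEq (k : ℕ) {θ : ℝ} (hθ : θ ∈ Ioo (0 : ℝ) 1) :
    rllCondEntropy k =ᶠ[𝓝 θ] fun s => pairEntropy (s / (1 + s)) (lagCov k (s / (1 + s))) := by
  filter_upwards [Ioo_mem_nhds hθ.1 hθ.2] with s hs
  exact rllCondEntropy_eq_pairEntropy (Ioo_subset_Icc_self hs) k

lemma div_one_add_mem_Ioo {θ : ℝ} (hθ : θ ∈ Ioo (0 : ℝ) 1) :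
    θ / (1 + θ) ∈ Ioo (0 : ℝ) (1 / 2) := by
  have h0 := hθ.1
  refine ⟨by positivity, (div_lt_div_iff₀ (by positivity) (by norm_num)).2 ?_⟩
  linarith [hθ.2]

theorem rllCondEntropy_curvature_nonpos (k : ℕ) (hk : k ≠ 0) {θ : ℝ} (hθ : θ ∈ Ioo (0 : ℝ) 1) :
    2 * deriv (rllCondEntropy k) θ + (1 + θ) * deriv (deriv (rllCondEntropy k)) θ ≤ 0 := by
  have probs {t : ℝ} (ht : t ∈ Ioo (0 : ℝ) (1 / 2)) : t ∈ Ioo (0 : ℝ) 1 ∧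
      (1 - t) ^ 2 + lagCov k t ≠ 0 ∧ t * (1 - t) - lagCov k t ≠ 0 ∧ t ^ 2 + lagCov k t ≠ 0 := by
    obtain ⟨ht0, ht1⟩ := ht
    have cov := abs_lt.1 (abs_lagCov_lt ⟨ht0, ht1⟩ hk)
    refine ⟨⟨ht0, by linarith⟩, ?_, ?_, ?_⟩ <;> exact ne_of_gt (by nlinarith)
  have ht := div_one_add_mem_Ioo hθ
  have hs : 0 < 1 + θ := by linarith [hθ.1]
  obtain ⟨ht', h00, h01, h11⟩ := probs ht
  rw [two_mul_deriv_add_mul_deriv_deriv_of_comp_div hs.ne' (rllCondEntropy_eventuallyEq k hθ)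
    (g := fun t => pairEntropy t (lagCov k t))
    (g' := fun t => pairSlope t (lagCov k t) (lagCov k t * lagRate k t)) ?_
    (hasDerivAt_pairSlope ht' h00 h01 h11 (hasDerivAt_lagCov ht')
      (hasDerivAt_lagCov_mul_lagRate ht'))]
  · exact div_nonpos_of_nonpos_of_nonneg (pairCurvature_lagCov_nonpos ht hk) (by positivity)
  · filter_upwards [Ioo_mem_nhds ht.1 ht.2] with t ht
    obtain ⟨ht', h00, h01, h11⟩ := probs ht
    exact hasDerivAt_pairEntropy ht' h00 h01 h11 (hasDerivAt_lagCov ht')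

lemma pairEntropy_lagCov_zero (t : ℝ) :
    pairEntropy t (lagCov 0 t) =
      Real.negMulLog (1 - 2 * t) + Real.negMulLog t - Real.negMulLog (1 - t) := by
  have cov : lagCov 0 t = -t ^ 2 := by simp [lagCov]
  have p00 : (1 - t) ^ 2 + -t ^ 2 = 1 - 2 * t := by ring
  have p01 : t * (1 - t) - -t ^ 2 = t := by ring
  rw [pairEntropy, cov, p00, p01, add_neg_cancel, Real.negMulLog_zero]
  ring

lemma hasDerivAt_pairEntropy_lagCov_zero {t : ℝ} (ht : t ∈ Ioo (0 : ℝ) (1 / 2)) :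
    HasDerivAt (fun s => pairEntropy s (lagCov 0 s))
      (2 * Real.log (1 - 2 * t) - Real.log t - Real.log (1 - t)) t := by
  simp only [pairEntropy_lagCov_zero]
  have dt := hasDerivAt_id t
  have d0 := hasDerivAt_negMulLog_comp ((dt.const_mul 2).const_sub 1)
    (ne_of_gt (by simp only [id]; linarith [ht.2]))
  have d1 := hasDerivAt_negMulLog_comp dt ht.1.ne'
  have d2 := hasDerivAt_negMulLog_comp (dt.const_sub 1)
    (ne_of_gt (by simp only [id]; linarith [ht.2]))
  refine ((d0.add d1).sub d2).congr_deriv ?_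
  simp only [id]
  ring

theorem rllCondEntropy_zero_curvature_neg {θ : ℝ} (hθ : θ ∈ Ioo (0 : ℝ) 1) :
    2 * deriv (rllCondEntropy 0) θ + (1 + θ) * deriv (deriv (rllCondEntropy 0)) θ < 0 := by
  have ht := div_one_add_mem_Ioo hθ
  have hs : 0 < 1 + θ := by linarith [hθ.1]
  set t := θ / (1 + θ)
  have ht0 := ht.1
  have ht1 : 0 < 1 - t := by linarith [ht.2]
  have ht2 : 0 < 1 - 2 * t := by linarith [ht.2]
  have dt := hasDerivAt_id t
  have slope : HasDerivAt (fun t => 2 * Real.log (1 - 2 * t) - Real.log t - Real.log (1 - t))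
      (-(4 / (1 - 2 * t)) - 1 / t + 1 / (1 - t)) t := by
    refine (((((dt.const_mul 2).const_sub 1).log ht2.ne').const_mul 2).sub
      (dt.log ht0.ne') |>.sub ((dt.const_sub 1).log ht1.ne')).congr_deriv ?_
    simp only [id]
    ring
  rw [two_mul_deriv_add_mul_deriv_deriv_of_comp_div hs.ne' (rllCondEntropy_eventuallyEq 0 hθ)
    (g := fun t => pairEntropy t (lagCov 0 t)) ?_ slope]
  · refine div_neg_of_neg_of_pos ?_ (by positivity)
    have : 1 / (1 - t) < 1 / t := one_div_lt_one_div_of_lt ht0 (by linarith [ht.2])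
    have : 0 < 4 / (1 - 2 * t) := by positivity
    linarith
  · filter_upwards [Ioo_mem_nhds ht.1 ht.2] with t ht using hasDerivAt_pairEntropy_lagCov_zero ht

/-! ### Analytic curves of bounded sequences -/

section PowerSeries

variable {E V : Type*} [NormedAddCommGroup E] [NormedSpace ℝ E] [NormedAddCommGroup V]
  [NormedSpace ℝ V] [CompleteSpace V]

lemma analyticOnNhd_sum_of_norm_le_one {p : FormalMultilinearSeries ℝ E V} (hp : ∀ n, ‖p n‖ ≤ 1) :
    AnalyticOnNhd ℝ p.sum (Metric.ball 0 1) := by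
  have radius : ((1 : NNReal) : ENNReal) ≤ p.radius :=
    p.le_radius_of_bound 1 fun n => by simpa using hp n
  refine (p.hasFPowerSeriesOnBall (lt_of_lt_of_le (by simp) radius)).analyticOnNhd.mono ?_
  rw [← Metric.eball_ofReal, ENNReal.ofReal_one]
  exact Metric.eball_subset_eball radius

lemma analyticOnNhd_tsum_pow_smul {c : ℕ → V} (hc : ∀ n, ‖c n‖ ≤ 1) :
    AnalyticOnNhd ℝ (fun t : ℝ => ∑' n, t ^ n • c n) (Metric.ball 0 1) := by
  refine (analyticOnNhd_sum_of_norm_le_one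
    (p := fun n => ContinuousMultilinearMap.mkPiRing ℝ (Fin n) (c n))
    fun n => by simpa using hc n).congr Metric.isOpen_ball fun t _ => ?_
  simp [FormalMultilinearSeries.sum]

lemma hasSum_pow_smul {c : ℕ → V} (hc : ∀ n, ‖c n‖ ≤ 1) {t : ℝ} (ht : |t| < 1) :
    HasSum (fun n => t ^ n • c n) (∑' n, t ^ n • c n) := by
  refine (Summable.of_norm_bounded (summable_geometric_of_lt_one (abs_nonneg t) ht)
    fun n => ?_).hasSum
  rw [norm_smul, norm_pow, Real.norm_eq_abs]
  exact mul_le_of_le_one_right (by positivity) (hc n)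

end PowerSeries

section BoundedFunctions

variable {X : Type*} [TopologicalSpace X] [Nonempty X]

lemma exists_analyticOnNhd_log_one_sub : ∃ L : (X →ᵇ ℝ) → X →ᵇ ℝ,
    AnalyticOnNhd ℝ L (Metric.ball 0 1) ∧
      ∀ f ∈ Metric.ball (0 : X →ᵇ ℝ) 1, ∀ x, L f x = Real.log (1 - f x) := by
  set p : FormalMultilinearSeries ℝ (X →ᵇ ℝ) (X →ᵇ ℝ) :=
    .ofScalars _ fun n : ℕ => (n : ℝ)⁻¹ with hp_def
  have hp (n : ℕ) : ‖p n‖ ≤ 1 := by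
    rw [hp_def, FormalMultilinearSeries.ofScalars_norm, norm_inv, Real.norm_natCast]
    exact Nat.cast_inv_le_one n
  refine ⟨fun f => -p.sum f, (analyticOnNhd_sum_of_norm_le_one hp).neg, fun f hf x => ?_⟩
  have summable : HasSum (fun n => p n fun _ => f) (p.sum f) := by
    refine p.hasSum (Metric.eball_subset_eball (ε₁ := 1) ?_ ?_)
    · exact p.le_radius_of_bound 1 fun n => by simpa using hp n
    · rwa [← ENNReal.ofReal_one, Metric.eball_ofReal]
  have coordinates : HasSum (fun n : ℕ => (n : ℝ)⁻¹ * f x ^ n) (p.sum f x) := by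
    simpa [hp_def, FormalMultilinearSeries.ofScalars_apply_eq] using
      summable.mapL (BoundedContinuousFunction.evalCLM ℝ x)
  have hfx : |f x| < 1 := (f.norm_coe_le_norm x).trans_lt (mem_ball_zero_iff.1 hf)
  have log := Real.hasSum_pow_div_log_of_abs_lt_one hfx
  rw [BoundedContinuousFunction.coe_neg, Pi.neg_apply, neg_eq_iff_eq_neg]
  refine coordinates.unique ((hasSum_nat_add_iff' 1).1 ?_)
  simpa [div_eq_inv_mul] using log

lemma exists_analyticOnNhd_negMulLog_one_add : ∃ N : (X →ᵇ ℝ) → X →ᵇ ℝ,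
    AnalyticOnNhd ℝ N (Metric.ball 0 1) ∧
      ∀ f ∈ Metric.ball (0 : X →ᵇ ℝ) 1, ∀ x, N f x = Real.negMulLog (1 + f x) := by
  obtain ⟨L, analytic, hL⟩ := exists_analyticOnNhd_log_one_sub (X := X)
  refine ⟨fun f => -(1 + f) * L (-f), fun f hf => ?_, fun f hf x => ?_⟩
  · have hf' : -f ∈ Metric.ball (0 : X →ᵇ ℝ) 1 := by simpa using hf
    exact (analyticAt_const.add analyticAt_id).neg.mul
      ((analytic _ hf').comp_of_eq analyticAt_id.neg rfl)
  · simp [hL (-f) (by simpa using hf), Real.negMulLog]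

end BoundedFunctions

lemma exists_analyticOnNhd_mul_pow {a : ℕ → ℝ} (ha : ∀ k, |a k| ≤ 1) (n : ℕ → ℕ) :
    ∃ U : ℝ → ℕ →ᵇ ℝ, AnalyticOnNhd ℝ U (Metric.ball 0 1) ∧
      ∀ t ∈ Metric.ball (0 : ℝ) 1, ∀ k, U t k = a k * t ^ n k := by
  have coeff (j k : ℕ) : |if n k = j then a k else 0| ≤ 1 := by
    split_ifs
    exacts [ha k, by simp]
  set c : ℕ → ℕ →ᵇ ℝ := fun j => BoundedContinuousFunction.ofNormedAddCommGroupDiscrete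
    (fun k => if n k = j then a k else 0) 1 (coeff j) with hc_def
  have hc (j : ℕ) : ‖c j‖ ≤ 1 :=
    (BoundedContinuousFunction.norm_le zero_le_one).2 fun k => coeff j k
  refine ⟨_, analyticOnNhd_tsum_pow_smul hc, fun t ht k => ?_⟩
  have coordinates := (hasSum_pow_smul hc (mem_ball_zero_iff.1 ht)).mapL
    (BoundedContinuousFunction.evalCLM ℝ k)
  refine coordinates.unique ((hasSum_ite_eq (n k) (a k * t ^ n k)).congr_fun fun j => ?_)
  simp only [hc_def, map_smul, BoundedContinuousFunction.evalCLM_apply,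
    BoundedContinuousFunction.ofNormedAddCommGroupDiscrete]
  rcases eq_or_ne j (n k) with rfl | hj
  · simp [mul_comm]
  · simp [hj, hj.symm]

lemma exists_analyticOnNhd_negMulLog_one_add_mul_pow {a : ℕ → ℝ} (ha : ∀ k, |a k| ≤ 1)
    {n : ℕ → ℕ} (hn : ∀ k, n k ≠ 0) :
    ∃ F : ℝ → ℕ →ᵇ ℝ, AnalyticOnNhd ℝ F (Metric.ball 0 1) ∧
      ∀ t ∈ Metric.ball (0 : ℝ) 1, ∀ k, F t k = Real.negMulLog (1 + a k * t ^ n k) := by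
  obtain ⟨U, analytic_U, hU⟩ := exists_analyticOnNhd_mul_pow ha n
  obtain ⟨N, analytic_N, hN⟩ := exists_analyticOnNhd_negMulLog_one_add (X := ℕ)
  have ball {t : ℝ} (ht : t ∈ Metric.ball (0 : ℝ) 1) : U t ∈ Metric.ball (0 : ℕ →ᵇ ℝ) 1 := by
    have ht1 : |t| < 1 := mem_ball_zero_iff.1 ht
    refine mem_ball_zero_iff.2 (lt_of_le_of_lt ?_ ht1)
    refine (BoundedContinuousFunction.norm_le (abs_nonneg t)).2 fun k => ?_
    rw [hU t ht, Real.norm_eq_abs, abs_mul, abs_pow]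
    exact (mul_le_of_le_one_left (by positivity) (ha k)).trans
      (pow_le_of_le_one (abs_nonneg t) ht1.le (hn k))
  exact ⟨fun t => N (U t), fun t ht => (analytic_N _ (ball ht)).comp (analytic_U t ht),
    fun t ht k => by rw [hN _ (ball ht), hU t ht]⟩

lemma exists_analyticOnNhd_negMulLog_one_sub_neg_pow :
    ∃ F : ℝ → ℕ →ᵇ ℝ, AnalyticOnNhd ℝ F (Metric.ball 0 1) ∧
      ∀ t ∈ Metric.ball (0 : ℝ) 1, ∀ k, F t k = Real.negMulLog (1 + -(-t) ^ k) := by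
  -- `negMulLog` is not analytic at `0`, its argument for `k = 0`, but vanishes there and at `1`.
  obtain ⟨F, analytic, hF⟩ := exists_analyticOnNhd_negMulLog_one_add_mul_pow
    (a := fun k => if k = 0 then 0 else -(-1) ^ k) (fun k => by split_ifs <;> simp)
    (n := fun k => max k 1) (by simp)
  refine ⟨F, analytic, fun t ht k => ?_⟩
  rw [hF t ht, neg_pow t k]
  rcases eq_or_ne k 0 with rfl | hk
  · simp
  · simp [hk, max_eq_left (Nat.one_le_iff_ne_zero.2 hk)]

lemma rllCondEntropy_eq_negMulLog {θ u : ℝ} {k : ℕ} (hθ : θ ∈ Icc (0 : ℝ) 1)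
    (hu : u = -(-θ) ^ k) :
    rllCondEntropy k θ = Real.log (1 + θ) + Real.negMulLog θ / (1 + θ) +
      (Real.negMulLog (1 + u * θ ^ 2) + 2 * θ * Real.negMulLog (1 - u * θ) +
        θ ^ 2 * Real.negMulLog (1 + u)) / (1 + θ) ^ 2 := by
  have hs : 1 + θ ≠ 0 := by linarith [hθ.1]
  have inv : Real.negMulLog (1 + θ)⁻¹ = (1 + θ)⁻¹ * Real.log (1 + θ) := by
    simp [Real.negMulLog]
  have complement : 1 - θ / (1 + θ) = (1 + θ)⁻¹ := by field_simp; ring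
  have p00 : ((1 + θ)⁻¹) ^ 2 + u * (θ / (1 + θ)) ^ 2 =
      (1 + u * θ ^ 2) * ((1 + θ)⁻¹ * (1 + θ)⁻¹) := by ring
  have p01 : θ / (1 + θ) * (1 + θ)⁻¹ - u * (θ / (1 + θ)) ^ 2 =
      θ * (1 - u * θ) * ((1 + θ)⁻¹ * (1 + θ)⁻¹) := by ring
  have p11 : (θ / (1 + θ)) ^ 2 + u * (θ / (1 + θ)) ^ 2 =
      θ * θ * (1 + u) * ((1 + θ)⁻¹ * (1 + θ)⁻¹) := by ring
  rw [rllCondEntropy_eq_pairEntropy hθ, lagCov_div hs, ← hu, pairEntropy, complement, p00, p01,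
    p11, div_eq_mul_inv θ]
  simp only [Real.negMulLog_mul, inv]
  field_simp
  ring

/-- The sequence `H_0(θ), H_1(θ), …` as an element of `ℓ^∞`. The parameter is clamped to `[0, 1]`,
where the entropies are bounded. -/
def entropySeq (θ : ℝ) : ℕ →ᵇ ℝ :=
  BoundedContinuousFunction.ofNormedAddCommGroupDiscrete
    (fun k => rllCondEntropy k (projIcc (0 : ℝ) 1 zero_le_one θ)) 1 fun k => by
      rw [Real.norm_eq_abs, abs_of_nonneg (rllCondEntropy_nonneg (Subtype.coe_prop _) k)]
      exact rllCondEntropy_le_one (Subtype.coe_prop _) k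

lemma entropySeq_apply {θ : ℝ} (hθ : θ ∈ Icc (0 : ℝ) 1) (k : ℕ) :
    entropySeq θ k = rllCondEntropy k θ := by
  simp [entropySeq, projIcc_of_mem zero_le_one hθ]

theorem analyticOnNhd_entropySeq : AnalyticOnNhd ℝ entropySeq (Ioo 0 1) := by
  obtain ⟨A, analytic_A, hA⟩ := exists_analyticOnNhd_negMulLog_one_add_mul_pow
    (a := fun k => -(-1) ^ k) (fun k => by simp) (n := fun k => k + 2) (by simp)
  obtain ⟨B, analytic_B, hB⟩ := exists_analyticOnNhd_negMulLog_one_add_mul_pow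
    (a := fun k => (-1) ^ k) (fun k => by simp) (n := fun k => k + 1) (by simp)
  obtain ⟨C, analytic_C, hC⟩ := exists_analyticOnNhd_negMulLog_one_sub_neg_pow
  have ball {θ : ℝ} (hθ : θ ∈ Ioo (0 : ℝ) 1) : θ ∈ Metric.ball (0 : ℝ) 1 := by
    simpa [abs_of_pos hθ.1] using hθ.2
  have formula : EqOn (fun θ => (Real.log (1 + θ) - θ * Real.log θ / (1 + θ)) • (1 : ℕ →ᵇ ℝ) +
      ((1 + θ) ^ 2)⁻¹ • (A θ + (2 * θ) • B θ + θ ^ 2 • C θ)) entropySeq (Ioo 0 1) := by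
    intro θ hθ
    ext k
    have hAk : A θ k = Real.negMulLog (1 + -(-θ) ^ k * θ ^ 2) := by
      rw [hA θ (ball hθ), neg_pow θ k]
      ring_nf
    have hBk : B θ k = Real.negMulLog (1 - -(-θ) ^ k * θ) := by
      rw [hB θ (ball hθ), neg_pow θ k]
      ring_nf
    rw [entropySeq_apply (Ioo_subset_Icc_self hθ),
      rllCondEntropy_eq_negMulLog (Ioo_subset_Icc_self hθ) rfl, ← hAk, ← hBk,
      ← hC θ (ball hθ) k, Real.negMulLog]
    simp only [BoundedContinuousFunction.coe_add, BoundedContinuousFunction.coe_smul,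
      BoundedContinuousFunction.coe_one, Pi.add_apply, Pi.one_apply, smul_eq_mul]
    ring
  refine AnalyticOnNhd.congr isOpen_Ioo (fun θ hθ => ?_) formula
  have hs : 0 < 1 + θ := by linarith [hθ.1]
  have := analytic_A θ (ball hθ)
  have := analytic_B θ (ball hθ)
  have := analytic_C θ (ball hθ)
  have : AnalyticAt ℝ Real.log θ := analyticAt_id.log hθ.1
  have : AnalyticAt ℝ (fun s => Real.log (1 + s)) θ := AnalyticAt.log (by fun_prop) hs
  fun_prop (disch := positivity)

/-- The functional that sends a bounded sequence `x` to `∑ ε ^ k * x k`. -/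
def geomEval (ε : ℝ) : (ℕ →ᵇ ℝ) →L[ℝ] ℝ :=
  ∑' k, ε ^ k • BoundedContinuousFunction.evalCLM ℝ k

lemma norm_evalCLM_le_one (k : ℕ) :
    ‖(BoundedContinuousFunction.evalCLM ℝ k : (ℕ →ᵇ ℝ) →L[ℝ] ℝ)‖ ≤ 1 :=
  ContinuousLinearMap.opNorm_le_bound _ zero_le_one fun x => by
    simpa using x.norm_coe_le_norm k

lemma analyticAt_geomEval {ε : ℝ} (hε : |ε| < 1) : AnalyticAt ℝ geomEval ε :=
  analyticOnNhd_tsum_pow_smul norm_evalCLM_le_one ε (mem_ball_zero_iff.2 hε)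

lemma hasSum_geomEval {ε : ℝ} (hε : |ε| < 1) (x : ℕ →ᵇ ℝ) :
    HasSum (fun k => ε ^ k * x k) (geomEval ε x) := by
  have functional := hasSum_pow_smul (V := (ℕ →ᵇ ℝ) →L[ℝ] ℝ)
    (c := fun k => BoundedContinuousFunction.evalCLM ℝ k) norm_evalCLM_le_one hε
  simpa only [geomEval, ContinuousLinearMap.apply_apply, _root_.smul_apply, smul_eq_mul,
    BoundedContinuousFunction.evalCLM_apply] using
    (ContinuousLinearMap.apply ℝ ℝ x).hasSum functional

lemma analyticAt_geomEval_apply {E : Type*} [NormedAddCommGroup E] [NormedSpace ℝ E] {e : E → ℝ}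
    {x : E → ℕ →ᵇ ℝ} {z : E} (hz : |e z| < 1) (he : AnalyticAt ℝ e z) (hx : AnalyticAt ℝ x z) :
    AnalyticAt ℝ (fun w => geomEval (e w) (x w)) z :=
  (ContinuousLinearMap.analyticAt_bilinear (ContinuousLinearMap.id ℝ ((ℕ →ᵇ ℝ) →L[ℝ] ℝ))
    (geomEval (e z), x z)).comp₂ ((analyticAt_geomEval hz).comp he) hx

/-- The pullback of bounded sequences along a partial map of the indices. -/
def reindex (f : ℕ → Option ℕ) : (ℕ →ᵇ ℝ) →L[ℝ] (ℕ →ᵇ ℝ) :=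
  LinearMap.mkContinuous
    { toFun := fun x => BoundedContinuousFunction.ofNormedAddCommGroupDiscrete
        (fun k => (f k).elim 0 x) ‖x‖ fun k => by
          cases f k with
          | none => simp
          | some j => simpa using x.norm_coe_le_norm j
      map_add' := fun x y => by ext k; cases h : f k <;> simp [h]
      map_smul' := fun c x => by ext k; cases h : f k <;> simp [h] } 1 fun x => by
    rw [one_mul]
    refine (BoundedContinuousFunction.norm_le (norm_nonneg x)).2 fun k => ?_
    cases h : f k with
    | none => simp [h]
    | some j => simpa [h] using x.norm_coe_le_norm j

/-- The shift of a sequence that drops its first entry. -/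
def leftShift : (ℕ →ᵇ ℝ) →L[ℝ] (ℕ →ᵇ ℝ) := reindex fun k => some (k + 1)

/-- The shift of a sequence that puts a zero in front. -/
def rightShift : (ℕ →ᵇ ℝ) →L[ℝ] (ℕ →ᵇ ℝ) :=
  reindex fun k => match k with
    | 0 => none
    | k + 1 => some k

@[simp] lemma leftShift_apply (x : ℕ →ᵇ ℝ) (k : ℕ) : leftShift x k = x (k + 1) := rfl

@[simp] lemma rightShift_zero (x : ℕ →ᵇ ℝ) : rightShift x 0 = 0 := rfl

@[simp] lemma rightShift_succ (x : ℕ →ᵇ ℝ) (k : ℕ) : rightShift x (k + 1) = x k := rfl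

@[simp] lemma leftShift_rightShift (x : ℕ →ᵇ ℝ) : leftShift (rightShift x) = x := rfl

lemma geomEval_eq_add {ε : ℝ} (hε : |ε| < 1) (x : ℕ →ᵇ ℝ) :
    geomEval ε x = x 0 + ε * geomEval ε (leftShift x) := by
  have tail : HasSum (fun k => ε ^ (k + 1) * x (k + 1)) (ε * geomEval ε (leftShift x)) := by
    simpa only [leftShift_apply, pow_succ', mul_assoc] using
      (hasSum_geomEval hε (leftShift x)).mul_left ε
  simpa using (hasSum_geomEval hε x).unique tail.zero_add

lemma geomEval_rightShift {ε : ℝ} (hε : |ε| < 1) (x : ℕ →ᵇ ℝ) :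
    geomEval ε (rightShift x) = ε * geomEval ε x := by
  rw [geomEval_eq_add hε, rightShift_zero, zero_add, leftShift_rightShift]

lemma analyticAt_coordinate {x : ℝ → ℕ →ᵇ ℝ} {ε : ℝ} (hx : AnalyticAt ℝ x ε) (k : ℕ) :
    AnalyticAt ℝ (fun t => x t k) ε :=
  ((BoundedContinuousFunction.evalCLM ℝ k : (ℕ →ᵇ ℝ) →L[ℝ] ℝ).analyticAt (x ε)).comp hx

lemma iteratedDeriv_id_mul {g : ℝ → ℝ} (n : ℕ) (hg : ContDiffAt ℝ n g 0) :
    iteratedDeriv n (fun t => t * g t) 0 = n * iteratedDeriv (n - 1) g 0 := by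
  rw [iteratedDeriv_fun_mul contDiffAt_fun_id hg]
  rcases n with _ | n
  · simp
  · rw [Finset.sum_eq_single 1 (fun i _ hi => ?_) (by simp)]
    · simp [iteratedDeriv_one]
    · rcases eq_or_ne i 0 with rfl | h
      · simp
      · simp [iteratedDeriv_fun_id, h, hi]

theorem iteratedDeriv_geomEval {x : ℝ → ℕ →ᵇ ℝ} (hx : AnalyticAt ℝ x 0) (n : ℕ) :
    iteratedDeriv n (fun t => geomEval t (x t)) 0 =
      ∑ k ∈ Finset.range (n + 1), (n.choose k : ℝ) * (k ! : ℝ) *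
        iteratedDeriv (n - k) (fun t => x t k) 0 := by
  have zero_lt : |(0 : ℝ)| < 1 := by simp
  induction n generalizing x with
  | zero => simpa using geomEval_eq_add zero_lt (x 0)
  | succ n ih =>
    have split : (fun t => geomEval t (x t)) =ᶠ[𝓝 0]
        fun t => x t 0 + t * geomEval t (leftShift (x t)) := by
      filter_upwards [eventually_abs_sub_lt 0 one_pos] with t ht
        using geomEval_eq_add (by simpa using ht) _
    have shift : AnalyticAt ℝ (fun t => leftShift (x t)) 0 := (leftShift.analyticAt _).comp hx
    have tail : AnalyticAt ℝ (fun t => geomEval t (leftShift (x t))) 0 :=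
      analyticAt_geomEval_apply zero_lt analyticAt_id shift
    have choose_mul_factorial (k : ℕ) : ((n + 1 : ℕ) : ℝ) * ((n.choose k : ℝ) * (k ! : ℝ)) =
        ((n + 1).choose (k + 1) : ℝ) * ((k + 1)! : ℝ) := by
      rw [Nat.factorial_succ, ← mul_assoc]
      norm_cast
      rw [Nat.add_one_mul_choose_eq, mul_assoc]
    rw [split.iteratedDeriv_eq, iteratedDeriv_fun_add (analyticAt_coordinate hx 0).contDiffAt
      (contDiffAt_fun_id.mul tail.contDiffAt), iteratedDeriv_id_mul _ tail.contDiffAt,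
      Nat.add_sub_cancel, ih shift, Finset.sum_range_succ' _ (n + 1), Finset.mul_sum, add_comm]
    simp [← choose_mul_factorial, mul_assoc]

lemma iteratedDeriv_comp_congr {f f₁ g g₁ : ℝ → ℝ} {x : ℝ} {n : ℕ} (hf : ContDiffAt ℝ n f x)
    (hf₁ : ContDiffAt ℝ n f₁ x) (hg : ContDiffAt ℝ n g (f x)) (hg₁ : ContDiffAt ℝ n g₁ (f x))
    (eq_f : ∀ i ≤ n, iteratedDeriv i f x = iteratedDeriv i f₁ x)
    (eq_g : ∀ i ≤ n, iteratedDeriv i g (f x) = iteratedDeriv i g₁ (f x)) :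
    iteratedDeriv n (g ∘ f) x = iteratedDeriv n (g₁ ∘ f₁) x := by
  have value : f x = f₁ x := by simpa using eq_f 0 n.zero_le
  rw [iteratedDeriv_comp_eq_sum_orderedFinpartition hg hf le_rfl,
    iteratedDeriv_comp_eq_sum_orderedFinpartition (value ▸ hg₁) hf₁ le_rfl]
  refine Finset.sum_congr rfl fun c _ => ?_
  rw [← value, eq_g _ c.length_le]
  congr 1
  exact Finset.prod_congr rfl fun j _ => eq_f _ (c.partSize_le j)

lemma iteratedDeriv_sum_mul_pow (c : ℕ → ℝ) (a : ℝ) {n i : ℕ} (hi : i ≤ n) :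
    iteratedDeriv i (fun t => ∑ j ∈ Finset.range (n + 1), c j * (t - a) ^ j) a = i ! * c i := by
  rw [iteratedDeriv_fun_sum fun j _ => by fun_prop, Finset.sum_eq_single i (fun j _ hj => ?_)
    fun h => absurd (Finset.mem_range.2 (Nat.lt_succ_of_le hi)) h]
  · rw [iteratedDeriv_const_mul _ (by fun_prop),
      iteratedDeriv_comp_sub_const i (fun t : ℝ => t ^ i) a]
    beta_reduce
    rw [sub_self, iteratedDeriv_fun_pow_zero, if_pos rfl, mul_comm]
  · rw [iteratedDeriv_const_mul _ (by fun_prop),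
      iteratedDeriv_comp_sub_const i (fun t : ℝ => t ^ j) a]
    beta_reduce
    rw [sub_self, iteratedDeriv_fun_pow_zero, if_neg hj.symm, Nat.cast_zero, mul_zero]

lemma iteratedDeriv_sum_mul_pow_succ_pow {N : ℕ} (b : Fin N → ℝ) (M : ℕ) :
    iteratedDeriv N (fun t => (∑ i, b i * t ^ ((i : ℕ) + 1)) ^ M) 0 =
      ∑ m ∈ Finset.univ.piAntidiag M with ∑ i : Fin N, ((i : ℕ) + 1) * m i = N,
        N ! * Nat.multinomial Finset.univ m * ∏ i, b i ^ m i := by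
  have monomial (m : Fin N → ℕ) (t : ℝ) : (Nat.multinomial Finset.univ m : ℝ) *
      ∏ i, (b i * t ^ ((i : ℕ) + 1)) ^ m i =
      Nat.multinomial Finset.univ m * (∏ i, b i ^ m i) *
        t ^ ∑ i : Fin N, ((i : ℕ) + 1) * m i := by
    simp only [mul_pow, Finset.prod_mul_distrib, ← pow_mul, Finset.prod_pow_eq_pow_sum, mul_assoc]
  simp only [Finset.sum_pow_eq_sum_piAntidiag, monomial]
  rw [iteratedDeriv_fun_sum fun m _ => by fun_prop, Finset.sum_filter]
  refine Finset.sum_congr rfl fun m _ => ?_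
  rw [iteratedDeriv_const_mul _ (by fun_prop), iteratedDeriv_fun_pow_zero]
  split_ifs with h h' h'
  · rw [mul_comm, h', mul_assoc]
  · exact absurd h.symm h'
  · exact absurd h'.symm h
  · rw [Nat.cast_zero, mul_zero]

lemma le_succ_mul_sum {N : ℕ} (m : Fin N → ℕ) : ∑ i, m i ≤ ∑ i : Fin N, ((i : ℕ) + 1) * m i :=
  Finset.sum_le_sum fun _ _ => Nat.le_mul_of_pos_left _ (Nat.succ_pos _)

lemma sum_le_of_mem_bruno {N : ℕ} {m : Fin N → ℕ} (hm : m ∈ bruno N) : ∑ i, m i ≤ N :=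
  (le_succ_mul_sum m).trans (Finset.mem_filter.1 hm).2.le

lemma mem_bruno {N : ℕ} {m : Fin N → ℕ} : m ∈ bruno N ↔ ∑ i : Fin N, ((i : ℕ) + 1) * m i = N := by
  refine Finset.mem_filter.trans (and_iff_right_of_imp fun h => ?_)
  refine Fintype.mem_piFinset.2 fun i => Finset.mem_range_succ_iff.2 ?_
  exact ((Finset.single_le_sum (fun _ _ => Nat.zero_le _) (Finset.mem_univ i)).trans
    (le_succ_mul_sum m)).trans h.le

lemma bruno_filter_sum_eq (N M : ℕ) : (bruno N).filter (fun m => ∑ i, m i = M) =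
    ((Finset.univ : Finset (Fin N)).piAntidiag M).filter
      fun m => ∑ i : Fin N, ((i : ℕ) + 1) * m i = N := by
  ext m
  simp [mem_bruno, and_comm]

lemma factorial_mul_multinomial_mul_prod {N : ℕ} (m : Fin N → ℕ) (x : Fin N → ℝ) :
    ((∑ i, m i)! : ℝ)⁻¹ * (N ! * Nat.multinomial Finset.univ m *
      ∏ i : Fin N, (x i / (((i : ℕ) + 1)! : ℝ)) ^ m i) = brunoCoeff m * ∏ i, x i ^ m i := by
  have factorials : (∏ i, ((m i)! : ℝ)) * Nat.multinomial Finset.univ m = (∑ i, m i)! := by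
    exact_mod_cast Nat.multinomial_spec Finset.univ m
  have sum_ne : ((∑ i, m i)! : ℝ) ≠ 0 := by positivity
  have entries_ne : ∏ i, ((m i)! : ℝ) ≠ 0 := by positivity
  have orders_ne : ∏ i : Fin N, ((((i : ℕ) + 1)! : ℝ) ^ m i) ≠ 0 := by positivity
  simp only [brunoCoeff, div_pow, Finset.prod_div_distrib, Finset.prod_mul_distrib]
  field_simp
  rw [← factorials]
  ring

/-- Both sides depend only on the Taylor polynomials of degree `N` of the two functions. -/
theorem iteratedDeriv_comp_eq_sum_bruno {f τ : ℝ → ℝ} (N : ℕ) (hτ : ContDiffAt ℝ N τ 0)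
    (hf : ContDiffAt ℝ N f (τ 0)) :
    iteratedDeriv N (fun t => f (τ t)) 0 = ∑ m ∈ bruno N,
      brunoCoeff m * iteratedDeriv (∑ i, m i) f (τ 0) *
        ∏ i : Fin N, iteratedDeriv ((i : ℕ) + 1) τ 0 ^ m i := by
  set c : ℕ → ℝ := fun j => iteratedDeriv j f (τ 0) / (j ! : ℝ)
  set b : ℕ → ℝ := fun j => iteratedDeriv j τ 0 / (j ! : ℝ) with hb
  have taylor : iteratedDeriv N (f ∘ τ) 0 = iteratedDeriv N
      ((fun z => ∑ j ∈ Finset.range (N + 1), c j * (z - τ 0) ^ j) ∘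
        fun t => ∑ j ∈ Finset.range (N + 1), b j * (t - 0) ^ j) 0 := by
    refine iteratedDeriv_comp_congr hτ (by fun_prop) hf (by fun_prop) ?_ ?_ <;>
    · intro i hi
      rw [iteratedDeriv_sum_mul_pow _ _ hi, mul_div_cancel₀ _ (by positivity)]
  have polynomial : ((fun z => ∑ j ∈ Finset.range (N + 1), c j * (z - τ 0) ^ j) ∘
      fun t => ∑ j ∈ Finset.range (N + 1), b j * (t - 0) ^ j) = fun t =>
        ∑ j ∈ Finset.range (N + 1), c j * (∑ i : Fin N, b (i + 1) * t ^ ((i : ℕ) + 1)) ^ j := by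
    funext t
    simp [Finset.sum_range_succ' _ N, Finset.sum_range, hb]
  have maps : ∀ m ∈ bruno N, ∑ i, m i ∈ Finset.range (N + 1) := fun m hm =>
    Finset.mem_range_succ_iff.2 (sum_le_of_mem_bruno hm)
  rw [← Function.comp_def, taylor, polynomial, iteratedDeriv_fun_sum fun j _ => by fun_prop,
    ← Finset.sum_fiberwise_of_maps_to maps]
  refine Finset.sum_congr rfl fun M _ => ?_
  rw [iteratedDeriv_const_mul _ (by fun_prop), iteratedDeriv_sum_mul_pow_succ_pow,
    bruno_filter_sum_eq, Finset.mul_sum]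
  refine Finset.sum_congr rfl fun m hm => ?_
  have hM : ∑ i, m i = M := (Finset.mem_piAntidiag.1 (Finset.mem_filter.1 hm).1).1
  have coeff := factorial_mul_multinomial_mul_prod m fun i => iteratedDeriv ((i : ℕ) + 1) τ 0
  rw [hM] at coeff ⊢
  linear_combination iteratedDeriv M f (τ 0) * coeff

/-! ### The optimal parameter -/

section Optimum

variable {ε θ : ℝ}

lemma abs_lt_one_of_mem_Ico (hε : ε ∈ Ico (0 : ℝ) 1) : |ε| < 1 :=
  (abs_of_nonneg hε.1).trans_lt hε.2

lemma lt_of_deriv_pos_of_deriv_neg {f : ℝ → ℝ} {a b c s : ℝ} (hf : ContinuousOn f (Icc a b))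
    (hc : c ∈ Icc a b) (pos : ∀ t ∈ Ioo a c, 0 < deriv f t)
    (neg : ∀ t ∈ Ioo c b, deriv f t < 0) (hs : s ∈ Icc a b) (hne : s ≠ c) : f s < f c := by
  rcases lt_or_gt_of_ne hne with h | h
  · refine strictMonoOn_of_deriv_pos (convex_Icc a c) (hf.mono (Icc_subset_Icc_right hc.2))
      (by rwa [interior_Icc]) ⟨hs.1, h.le⟩ (right_mem_Icc.2 hc.1) h
  · refine strictAntiOn_of_deriv_neg (convex_Icc c b) (hf.mono (Icc_subset_Icc_left hc.1))
      (by rwa [interior_Icc]) (left_mem_Icc.2 hc.2) ⟨h.le, hs.2⟩ h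

lemma deriv_coordinate {x : ℝ → ℕ →ᵇ ℝ} (hx : DifferentiableAt ℝ x θ) (k : ℕ) :
    deriv x θ k = deriv (fun t => x t k) θ :=
  ((BoundedContinuousFunction.evalCLM ℝ k : (ℕ →ᵇ ℝ) →L[ℝ] ℝ).hasFDerivAt.comp_hasDerivAt θ
    hx.hasDerivAt).deriv.symm

lemma entropySeq_eventuallyEq (hθ : θ ∈ Ioo (0 : ℝ) 1) (k : ℕ) :
    (fun s => entropySeq s k) =ᶠ[𝓝 θ] rllCondEntropy k := by
  filter_upwards [Ioo_mem_nhds hθ.1 hθ.2] with s hs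
  exact entropySeq_apply (Ioo_subset_Icc_self hs) k

lemma analyticAt_rllCondEntropy (hθ : θ ∈ Ioo (0 : ℝ) 1) (k : ℕ) :
    AnalyticAt ℝ (rllCondEntropy k) θ :=
  (analyticAt_coordinate (analyticOnNhd_entropySeq θ hθ) k).congr (entropySeq_eventuallyEq hθ k)

lemma deriv_entropySeq_apply (hθ : θ ∈ Ioo (0 : ℝ) 1) (k : ℕ) :
    deriv entropySeq θ k = deriv (rllCondEntropy k) θ := by
  rw [deriv_coordinate (analyticOnNhd_entropySeq θ hθ).differentiableAt,
    (entropySeq_eventuallyEq hθ k).deriv_eq]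

lemma deriv_deriv_entropySeq_apply (hθ : θ ∈ Ioo (0 : ℝ) 1) (k : ℕ) :
    deriv (deriv entropySeq) θ k = deriv (deriv (rllCondEntropy k)) θ := by
  have first : (fun s => deriv entropySeq s k) =ᶠ[𝓝 θ] deriv (rllCondEntropy k) := by
    filter_upwards [Ioo_mem_nhds hθ.1 hθ.2] with s hs using deriv_entropySeq_apply hs k
  rw [deriv_coordinate (analyticOnNhd_entropySeq θ hθ).deriv.differentiableAt, first.deriv_eq]

lemma rllRate_eq_geomEval (hε : ε ∈ Ico (0 : ℝ) 1) (hθ : θ ∈ Icc (0 : ℝ) 1) :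
    rllRate ε θ = (1 - ε) ^ 2 * geomEval ε (entropySeq θ) := by
  simp only [rllRate_eq hε hθ, ← entropySeq_apply hθ,
    (hasSum_geomEval (abs_lt_one_of_mem_Ico hε) _).tsum_eq]

/-- The derivative with respect to `θ` of the rate without its factor `(1 - ε) ^ 2`. -/
def critFun (ε θ : ℝ) : ℝ := geomEval ε (deriv entropySeq θ)

lemma hasDerivAt_rllRate (hε : ε ∈ Ico (0 : ℝ) 1) (hθ : θ ∈ Ioo (0 : ℝ) 1) :
    HasDerivAt (rllRate ε) ((1 - ε) ^ 2 * critFun ε θ) θ := by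
  have series : rllRate ε =ᶠ[𝓝 θ] fun s => (1 - ε) ^ 2 * geomEval ε (entropySeq s) := by
    filter_upwards [Ioo_mem_nhds hθ.1 hθ.2] with s hs
    exact rllRate_eq_geomEval hε (Ioo_subset_Icc_self hs)
  exact (((geomEval ε).hasFDerivAt.comp_hasDerivAt θ
    (analyticOnNhd_entropySeq θ hθ).differentiableAt.hasDerivAt).const_mul _).congr_of_eventuallyEq
      series

lemma continuousOn_rllRate (hε : ε ∈ Ico (0 : ℝ) 1) : ContinuousOn (rllRate ε) (Icc 0 1) := by
  have series : ContinuousOn (fun θ => ∑' k, ε ^ k * rllCondEntropy k θ) (Icc 0 1) := by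
    refine continuousOn_tsum (fun k => continuousOn_const.mul (continuousOn_rllCondEntropy k))
      (summable_geometric_of_lt_one hε.1 hε.2) fun k θ hθ => ?_
    have power := pow_nonneg hε.1 k
    rw [Real.norm_of_nonneg (mul_nonneg power (rllCondEntropy_nonneg hθ k))]
    exact mul_le_of_le_one_right power (rllCondEntropy_le_one hθ k)
  exact (continuousOn_const.mul series).congr fun θ hθ => rllRate_eq hε hθ

lemma hasDerivAt_critFun (ε : ℝ) (hθ : θ ∈ Ioo (0 : ℝ) 1) :
    HasDerivAt (critFun ε) (geomEval ε (deriv (deriv entropySeq) θ)) θ :=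
  (geomEval ε).hasFDerivAt.comp_hasDerivAt θ
    (analyticOnNhd_entropySeq θ hθ).deriv.differentiableAt.hasDerivAt

lemma two_mul_critFun_add_neg (hε : ε ∈ Ico (0 : ℝ) 1) (hθ : θ ∈ Ioo (0 : ℝ) 1) :
    2 * critFun ε θ + (1 + θ) * geomEval ε (deriv (deriv entropySeq) θ) < 0 := by
  set x : ℕ →ᵇ ℝ := (2 : ℝ) • deriv entropySeq θ + (1 + θ) • deriv (deriv entropySeq) θ with hx
  have entry (k : ℕ) : x k =
      2 * deriv (rllCondEntropy k) θ + (1 + θ) * deriv (deriv (rllCondEntropy k)) θ := by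
    simp [hx, deriv_entropySeq_apply hθ, deriv_deriv_entropySeq_apply hθ]
  have entry_zero : x 0 < 0 := by
    rw [entry]
    exact rllCondEntropy_zero_curvature_neg hθ
  have entry_nonpos (k : ℕ) : x k ≤ 0 := by
    rcases eq_or_ne k 0 with rfl | hk
    · exact entry_zero.le
    · rw [entry]
      exact rllCondEntropy_curvature_nonpos k hk hθ
  have neg : geomEval ε x < 0 :=
    hasSum_lt (i := 0) (fun k => mul_nonpos_of_nonneg_of_nonpos (pow_nonneg hε.1 k)
      (entry_nonpos k)) (by simpa using entry_zero)
      (hasSum_geomEval (abs_lt_one_of_mem_Ico hε) x) hasSum_zero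
  simpa only [critFun, hx, map_add, map_smul, smul_eq_mul] using neg

lemma strictAntiOn_sq_mul_critFun (hε : ε ∈ Ico (0 : ℝ) 1) :
    StrictAntiOn (fun θ => (1 + θ) ^ 2 * critFun ε θ) (Ioo 0 1) := by
  have deriv_eq {θ : ℝ} (hθ : θ ∈ Ioo (0 : ℝ) 1) :
      HasDerivAt (fun θ => (1 + θ) ^ 2 * critFun ε θ) ((1 + θ) *
        (2 * critFun ε θ + (1 + θ) * geomEval ε (deriv (deriv entropySeq) θ))) θ :=
    ((((hasDerivAt_id θ).const_add 1).pow 2).mul (hasDerivAt_critFun ε hθ)).congr_deriv (by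
      simp only [Nat.cast_ofNat, id_eq, Nat.add_one_sub_one, pow_one, mul_one, Pi.pow_apply]
      ring)
  refine strictAntiOn_of_deriv_neg (convex_Ioo 0 1)
    (fun θ hθ => (deriv_eq hθ).continuousAt.continuousWithinAt) fun θ hθ => ?_
  rw [interior_Ioo] at hθ
  rw [(deriv_eq hθ).deriv]
  exact mul_neg_of_pos_of_neg (by linarith [hθ.1]) (two_mul_critFun_add_neg hε hθ)

lemma critFun_pos_of_lt {t : ℝ} (hε : ε ∈ Ico (0 : ℝ) 1) (hθ : θ ∈ Ioo (0 : ℝ) 1)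
    (hcrit : critFun ε θ = 0) (ht : t ∈ Ioo (0 : ℝ) 1) (hlt : t < θ) : 0 < critFun ε t := by
  have lt := strictAntiOn_sq_mul_critFun hε ht hθ hlt
  simp only [hcrit, mul_zero] at lt
  exact pos_of_mul_pos_right lt (sq_nonneg _)

lemma critFun_neg_of_gt {t : ℝ} (hε : ε ∈ Ico (0 : ℝ) 1) (hθ : θ ∈ Ioo (0 : ℝ) 1)
    (hcrit : critFun ε θ = 0) (ht : t ∈ Ioo (0 : ℝ) 1) (hlt : θ < t) : critFun ε t < 0 := by
  have lt := strictAntiOn_sq_mul_critFun hε hθ ht hlt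
  simp only [hcrit, mul_zero] at lt
  exact neg_of_mul_neg_right lt (sq_nonneg _)

lemma exists_critFun_eq_zero (hε : ε ∈ Ico (0 : ℝ) 1) :
    ∃ θ, θ ∈ Ioo (0 : ℝ) 1 ∧ critFun ε θ = 0 := by
  have ends : rllRate ε 0 = rllRate ε 1 := by
    simp [rllRate_eq hε, rllCondEntropy_zero, rllCondEntropy_one]
  obtain ⟨θ, hθ, hzero⟩ := exists_hasDerivAt_eq_zero one_pos (continuousOn_rllRate hε) ends
    fun θ hθ => hasDerivAt_rllRate hε hθ
  exact ⟨θ, hθ, (mul_eq_zero.1 hzero).resolve_left (pow_ne_zero 2 (sub_pos.2 hε.2).ne')⟩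

/-- The parameter that maximizes the rate for the erasure probability `ε ∈ [0, 1)`, encoded as
the zero of `critFun ε`. -/
def optimalParam (ε : ℝ) : ℝ := Classical.epsilon fun θ => θ ∈ Ioo (0 : ℝ) 1 ∧ critFun ε θ = 0

lemma optimalParam_mem (hε : ε ∈ Ico (0 : ℝ) 1) : optimalParam ε ∈ Ioo (0 : ℝ) 1 :=
  (Classical.epsilon_spec (exists_critFun_eq_zero hε)).1

lemma critFun_optimalParam (hε : ε ∈ Ico (0 : ℝ) 1) : critFun ε (optimalParam ε) = 0 :=
  (Classical.epsilon_spec (exists_critFun_eq_zero hε)).2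

lemma optimalParam_eq_of_critFun_eq_zero (hε : ε ∈ Ico (0 : ℝ) 1) (hθ : θ ∈ Ioo (0 : ℝ) 1)
    (hcrit : critFun ε θ = 0) : optimalParam ε = θ :=
  (strictAntiOn_sq_mul_critFun hε).injOn (optimalParam_mem hε) hθ
    (by simp only [critFun_optimalParam hε, hcrit, mul_zero])

theorem isOptimalParam_optimalParam (hε : ε ∈ Ico (0 : ℝ) 1) :
    IsOptimalParam ε (optimalParam ε) := by
  have hθ := optimalParam_mem hε
  have hcrit := critFun_optimalParam hε
  have factor : 0 < (1 - ε) ^ 2 := pow_pos (sub_pos.2 hε.2) 2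
  refine ⟨Ioo_subset_Icc_self hθ, fun s hs hne => lt_of_deriv_pos_of_deriv_neg
    (continuousOn_rllRate hε) (Ioo_subset_Icc_self hθ) (fun t ht => ?_) (fun t ht => ?_) hs hne⟩
  · have ht' : t ∈ Ioo (0 : ℝ) 1 := ⟨ht.1, ht.2.trans hθ.2⟩
    rw [(hasDerivAt_rllRate hε ht').deriv]
    exact mul_pos factor (critFun_pos_of_lt hε hθ hcrit ht' ht.2)
  · have ht' : t ∈ Ioo (0 : ℝ) 1 := ⟨hθ.1.trans ht.1, ht.2⟩
    rw [(hasDerivAt_rllRate hε ht').deriv]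
    exact mul_neg_of_pos_of_neg factor (critFun_neg_of_gt hε hθ hcrit ht' ht.1)

theorem isGreatest_markovRates (hε : ε ∈ Ico (0 : ℝ) 1) :
    IsGreatest (markovRates ε) (rllRate ε (optimalParam ε)) := by
  obtain ⟨hθ, hmax⟩ := isOptimalParam_optimalParam hε
  rw [markovRates_eq]
  refine ⟨mem_image_of_mem _ hθ, ?_⟩
  rintro _ ⟨s, hs, rfl⟩
  rcases eq_or_ne s (optimalParam ε) with rfl | hne
  · exact le_rfl
  · exact (hmax s hs hne).le

lemma markovCapacity_eq (hε : ε ∈ Ico (0 : ℝ) 1) :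
    markovCapacity ε = rllRate ε (optimalParam ε) :=
  (isGreatest_markovRates hε).csSup_eq

lemma isLUB_markovCapacity (hε : ε ∈ Ico (0 : ℝ) 1) :
    IsLUB (markovRates ε) (markovCapacity ε) := by
  rw [markovCapacity_eq hε]
  exact (isGreatest_markovRates hε).isLUB

lemma markovCapacity_eq_geomEval (hε : ε ∈ Ico (0 : ℝ) 1) :
    markovCapacity ε = (1 - ε) ^ 2 * geomEval ε (entropySeq (optimalParam ε)) := by
  rw [markovCapacity_eq hε, rllRate_eq_geomEval hε (Ioo_subset_Icc_self (optimalParam_mem hε))]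

lemma geomEval_deriv_deriv_neg (hε : ε ∈ Ico (0 : ℝ) 1) :
    geomEval ε (deriv (deriv entropySeq) (optimalParam ε)) < 0 := by
  have hθ := optimalParam_mem hε
  have neg := two_mul_critFun_add_neg hε hθ
  rw [critFun_optimalParam hε, mul_zero, zero_add] at neg
  exact neg_of_mul_neg_right neg (by linarith [hθ.1])

theorem exists_analyticAt_implicit {F : ℝ × ℝ → ℝ} {a b c : ℝ} (hF : AnalyticAt ℝ F (a, b))
    (hzero : F (a, b) = 0) (hc : HasDerivAt (fun y => F (a, y)) c b) (hne : c ≠ 0) :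
    ∃ τ : ℝ → ℝ, AnalyticAt ℝ τ a ∧ τ a = b ∧ ∀ᶠ t in 𝓝 a, F (t, τ t) = 0 := by
  have smooth : ContDiffAt ℝ ω F (a, b) := hF.contDiffAt
  have partial_eq : fderiv ℝ F (a, b) (0, 1) = c :=
    (hF.differentiableAt.hasFDerivAt.comp_hasDerivAt b
      ((hasDerivAt_const b a).prodMk (hasDerivAt_id' b))).unique hc
  have invertible : (fderiv ℝ F (a, b) ∘L .inr ℝ ℝ ℝ).IsInvertible := by
    refine ⟨ContinuousLinearEquiv.unitsEquivAut ℝ (Units.mk0 c hne), ?_⟩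
    ext
    simp [partial_eq]
  refine ⟨smooth.implicitFunction (by simp) invertible,
    (smooth.contDiffAt_implicitFunction _ invertible).analyticAt,
    smooth.implicitFunction_apply_self _ invertible, ?_⟩
  filter_upwards [smooth.eventually_apply_implicitFunction (by simp) invertible] with t ht
  exact ht.trans hzero

theorem exists_analyticAt_optimalParam (hε : ε ∈ Ico (0 : ℝ) 1) :
    ∃ τ : ℝ → ℝ, AnalyticAt ℝ τ ε ∧ τ ε = optimalParam ε ∧
      (∀ᶠ t in 𝓝 ε, τ t ∈ Ioo (0 : ℝ) 1 ∧ critFun t (τ t) = 0) ∧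
      optimalParam =ᶠ[𝓝[Ico 0 1] ε] τ := by
  have hθ := optimalParam_mem hε
  have curve : AnalyticAt ℝ (deriv entropySeq) (optimalParam ε) :=
    (analyticOnNhd_entropySeq _ hθ).deriv
  have analytic : AnalyticAt ℝ (fun z : ℝ × ℝ => critFun z.1 z.2) (ε, optimalParam ε) :=
    analyticAt_geomEval_apply (abs_lt_one_of_mem_Ico hε) analyticAt_fst
      (curve.comp_of_eq analyticAt_snd rfl)
  obtain ⟨τ, hτ, value, crit⟩ := exists_analyticAt_implicit analytic (critFun_optimalParam hε)
    (hasDerivAt_critFun ε hθ) (geomEval_deriv_deriv_neg hε).ne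
  have near : ∀ᶠ t in 𝓝 ε, τ t ∈ Ioo (0 : ℝ) 1 ∧ critFun t (τ t) = 0 :=
    (hτ.continuousAt.eventually_mem (isOpen_Ioo.mem_nhds (by rwa [value]))).and crit
  refine ⟨τ, hτ, value, near, ?_⟩
  filter_upwards [nhdsWithin_le_nhds near, self_mem_nhdsWithin] with t ⟨mem, zero⟩ ht
  exact optimalParam_eq_of_critFun_eq_zero ht mem zero

end Optimum

/-! ### The expansion at zero -/

lemma zero_mem_Ico : (0 : ℝ) ∈ Ico (0 : ℝ) 1 := by simp

lemma geomEval_zero (x : ℕ →ᵇ ℝ) : geomEval 0 x = x 0 := by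
  rw [geomEval_eq_add (by simp), zero_mul, add_zero]

lemma deriv_rllCondEntropy_zero {θ : ℝ} (hθ : θ ∈ Ioo (0 : ℝ) 1) :
    deriv (rllCondEntropy 0) θ = (2 * Real.log (1 - θ) - Real.log θ) / (1 + θ) ^ 2 := by
  have hs : 1 + θ ≠ 0 := by linarith [hθ.1]
  have chain := (hasDerivAt_pairEntropy_lagCov_zero (div_one_add_mem_Ioo hθ)).comp θ
    (hasDerivAt_div_one_add hs)
  have two_sub : 1 - 2 * (θ / (1 + θ)) = (1 - θ) / (1 + θ) := by field_simp; ring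
  have one_sub : 1 - θ / (1 + θ) = (1 + θ)⁻¹ := by field_simp; ring
  rw [(rllCondEntropy_eventuallyEq 0 hθ).deriv_eq]
  refine chain.deriv.trans ?_
  rw [two_sub, one_sub, Real.log_div (sub_pos.2 hθ.2).ne' hs, Real.log_div hθ.1.ne' hs,
    Real.log_inv]
  ring

lemma one_div_sq_goldenRatio_mem : 1 / Real.goldenRatio ^ 2 ∈ Ioo (0 : ℝ) 1 := by
  have := Real.goldenRatio_pos
  exact ⟨by positivity,
    (div_lt_one (by positivity)).2 (one_lt_pow₀ Real.one_lt_goldenRatio two_ne_zero)⟩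

lemma one_sub_one_div_sq_goldenRatio :
    1 - 1 / Real.goldenRatio ^ 2 = Real.goldenRatio⁻¹ := by
  have sq := Real.goldenRatio_sq
  have pos := Real.goldenRatio_pos
  generalize Real.goldenRatio = g at *
  field_simp
  linarith

theorem optimalParam_zero : optimalParam 0 = 1 / Real.goldenRatio ^ 2 := by
  have mem := one_div_sq_goldenRatio_mem
  refine optimalParam_eq_of_critFun_eq_zero zero_mem_Ico mem ?_
  rw [critFun, geomEval_zero, deriv_entropySeq_apply mem, deriv_rllCondEntropy_zero mem,
    one_sub_one_div_sq_goldenRatio, one_div, Real.log_inv, Real.log_inv, Real.log_pow,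
    Nat.cast_two, mul_neg, sub_self, zero_div]

lemma iteratedDeriv_two_rllCondEntropy_ne_zero :
    iteratedDeriv 2 (rllCondEntropy 0) (1 / Real.goldenRatio ^ 2) ≠ 0 := by
  have neg := geomEval_deriv_deriv_neg zero_mem_Ico
  rw [geomEval_zero, optimalParam_zero, deriv_deriv_entropySeq_apply one_div_sq_goldenRatio_mem]
    at neg
  rw [iteratedDeriv_succ, iteratedDeriv_one]
  exact neg.ne

section Analyticity

variable {f g τ : ℝ → ℝ} {ε : ℝ}

lemma derivAtZero_eq (h : f =ᶠ[𝓝[Ico 0 1] 0] g) (hg : AnalyticAt ℝ g 0) (n : ℕ) :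
    derivAtZero f n = iteratedDeriv n g 0 := by
  rw [derivAtZero, h.iteratedDerivWithin_eq (h.eq_of_nhdsWithin zero_mem_Ico),
    iteratedDerivWithin_eq_iteratedDeriv (uniqueDiffOn_Ico 0 1) hg.contDiffAt zero_mem_Ico]

lemma analyticWithinAt_of_eventuallyEq {s : Set ℝ} (hε : ε ∈ s) (h : f =ᶠ[𝓝[s] ε] g)
    (hg : AnalyticAt ℝ g ε) : AnalyticWithinAt ℝ f s ε :=
  hg.analyticWithinAt.congr_of_eventuallyEq h (h.eq_of_nhdsWithin hε)

theorem analyticOn_optimalParam : AnalyticOn ℝ optimalParam (Ico 0 1) := fun ε hε => by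
  obtain ⟨τ, hτ, -, -, eq⟩ := exists_analyticAt_optimalParam hε
  exact analyticWithinAt_of_eventuallyEq hε eq hτ

lemma analyticAt_entropySeq_comp (hτ : AnalyticAt ℝ τ ε) (h : τ ε ∈ Ioo (0 : ℝ) 1) :
    AnalyticAt ℝ (fun t => entropySeq (τ t)) ε :=
  (analyticOnNhd_entropySeq _ h).fun_comp hτ

theorem analyticOn_entropyAlong (k : ℕ) :
    AnalyticOn ℝ (entropyAlong optimalParam k) (Ico 0 1) := fun ε hε => by
  have analytic := analyticAt_rllCondEntropy (optimalParam_mem hε) k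
  exact analytic.comp_analyticWithinAt (analyticOn_optimalParam ε hε)

lemma markovCapacity_eventuallyEq (h : optimalParam =ᶠ[𝓝[Ico 0 1] ε] τ) :
    markovCapacity =ᶠ[𝓝[Ico 0 1] ε] fun t => (1 - t) ^ 2 * geomEval t (entropySeq (τ t)) := by
  filter_upwards [h, self_mem_nhdsWithin] with t ht mem
  rw [markovCapacity_eq_geomEval mem, ht]

lemma analyticAt_sq_mul_geomEval {x : ℝ → ℕ →ᵇ ℝ} (hε : |ε| < 1) (hx : AnalyticAt ℝ x ε) :
    AnalyticAt ℝ (fun t => (1 - t) ^ 2 * geomEval t (x t)) ε :=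
  AnalyticAt.fun_mul (by fun_prop) (analyticAt_geomEval_apply hε analyticAt_id hx)

theorem analyticOn_markovCapacity : AnalyticOn ℝ markovCapacity (Ico 0 1) := fun ε hε => by
  obtain ⟨τ, hτ, value, -, eq⟩ := exists_analyticAt_optimalParam hε
  exact analyticWithinAt_of_eventuallyEq hε (markovCapacity_eventuallyEq eq)
    (analyticAt_sq_mul_geomEval (abs_lt_one_of_mem_Ico hε)
      (analyticAt_entropySeq_comp hτ (value ▸ optimalParam_mem hε)))

end Analyticity

/-! ### The derivatives of the optimal parameter -/

lemma forall_last_eq_zero_iff {N : ℕ} {m : Fin (N + 1) → ℕ} :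
    (∀ i : Fin (N + 1), (i : ℕ) + 1 = N + 1 → m i = 0) ↔ m (Fin.last N) = 0 := by
  refine ⟨fun h => h _ rfl, fun h i hi => ?_⟩
  rwa [show i = Fin.last N from Fin.ext (Nat.succ_injective hi)]

lemma succ_mul_sum_single_last (N : ℕ) :
    ∑ i : Fin (N + 1), ((i : ℕ) + 1) * (Pi.single (Fin.last N) 1 : Fin (N + 1) → ℕ) i = N + 1 := by
  simp [Pi.single_apply]

lemma eq_single_last_of_mem_bruno {N : ℕ} {m : Fin (N + 1) → ℕ} (hm : m ∈ bruno (N + 1))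
    (hne : m (Fin.last N) ≠ 0) : m = Pi.single (Fin.last N) 1 := by
  have single_le : (Pi.single (Fin.last N) 1 : Fin (N + 1) → ℕ) ≤ m := fun i => by
    rcases eq_or_ne i (Fin.last N) with rfl | hi
    · simpa using Nat.one_le_iff_ne_zero.2 hne
    · simp [hi]
  have sums_eq := (succ_mul_sum_single_last N).trans (mem_bruno.1 hm).symm
  have terms_eq := (Finset.sum_eq_sum_iff_of_le fun (i : Fin (N + 1)) _ =>
    Nat.mul_le_mul_left ((i : ℕ) + 1) (single_le i)).1 sums_eq
  exact funext fun i => (Nat.eq_of_mul_eq_mul_left (Nat.succ_pos _)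
    (terms_eq i (Finset.mem_univ i))).symm

lemma bruno_filter_not (N : ℕ) :
    (bruno (N + 1)).filter (fun m => ¬ ∀ i : Fin (N + 1), (i : ℕ) + 1 = N + 1 → m i = 0) =
      {Pi.single (Fin.last N) 1} := by
  ext m
  rw [Finset.mem_filter, forall_last_eq_zero_iff, Finset.mem_singleton]
  refine ⟨fun h => eq_single_last_of_mem_bruno h.1 h.2, ?_⟩
  rintro rfl
  exact ⟨mem_bruno.2 (succ_mul_sum_single_last N), by simp⟩

lemma brunoTerm_single_last (F : ℝ → ℝ) (t : ℝ) (d : ℕ → ℝ) (N : ℕ) :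
    brunoTerm F t d (Pi.single (Fin.last N) 1 : Fin (N + 1) → ℕ) =
      iteratedDeriv 2 F t * d (N + 1) := by
  have prod_pow (g : Fin (N + 1) → ℝ) :
      ∏ i, g i ^ (Pi.single (Fin.last N) 1 : Fin (N + 1) → ℕ) i = g (Fin.last N) := by
    simp [Pi.single_apply]
  have factorials : ∏ i, (((Pi.single (Fin.last N) 1 : Fin (N + 1) → ℕ) i)! : ℝ) = 1 :=
    Finset.prod_eq_one fun i _ => by
      by_cases h : i = Fin.last N <;> simp [h]
  have factorial_ne : ((N + 1)! : ℝ) ≠ 0 := by positivity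
  rw [brunoTerm, brunoCoeff, prod_pow fun i => d ((i : ℕ) + 1), Finset.prod_mul_distrib,
    factorials, prod_pow fun i => (((i : ℕ) + 1)! : ℝ), one_mul, Fin.val_last,
    div_self factorial_ne, one_mul, Finset.sum_pi_single', if_pos (Finset.mem_univ _)]

lemma sum_brunoTerm_succ (F : ℝ → ℝ) (t : ℝ) (d : ℕ → ℝ) (N : ℕ) :
    ∑ m ∈ bruno (N + 1), brunoTerm F t d m =
      (∑ m ∈ bruno (N + 1) with ∀ i : Fin (N + 1), (i : ℕ) + 1 = N + 1 → m i = 0,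
        brunoTerm F t d m) + iteratedDeriv 2 F t * d (N + 1) := by
  rw [← Finset.sum_filter_add_sum_filter_not (bruno (N + 1))
    (fun m => ∀ i : Fin (N + 1), (i : ℕ) + 1 = N + 1 → m i = 0), bruno_filter_not,
    Finset.sum_singleton, brunoTerm_single_last]

lemma iteratedDeriv_deriv_comp_eq_sum_brunoTerm {F τ : ℝ → ℝ} {N : ℕ} (hτ : ContDiffAt ℝ N τ 0)
    (hF : ContDiffAt ℝ N (deriv F) (τ 0)) :
    iteratedDeriv N (fun t => deriv F (τ t)) 0 =
      ∑ m ∈ bruno N, brunoTerm F (τ 0) (fun j => iteratedDeriv j τ 0) m := by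
  simp only [iteratedDeriv_comp_eq_sum_bruno N hτ hF, brunoTerm, iteratedDeriv_succ']

lemma sum_sum_brunoTerm_eq_zero (n : ℕ) :
    ∑ k ∈ Finset.range (n + 1), (n.choose k : ℝ) * (k ! : ℝ) *
      ∑ m ∈ bruno (n - k), brunoTerm (rllCondEntropy k) (1 / Real.goldenRatio ^ 2)
        (derivAtZero optimalParam) m = 0 := by
  obtain ⟨τ, hτ, value, crit, eq⟩ := exists_analyticAt_optimalParam zero_mem_Ico
  have mem : τ 0 ∈ Ioo (0 : ℝ) 1 := value ▸ optimalParam_mem zero_mem_Ico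
  have derivs : derivAtZero optimalParam = fun j => iteratedDeriv j τ 0 :=
    funext fun j => derivAtZero_eq eq hτ j
  have curve : AnalyticAt ℝ (fun t => deriv entropySeq (τ t)) 0 :=
    (analyticOnNhd_entropySeq _ mem).deriv.fun_comp hτ
  have vanishes : (fun t => geomEval t (deriv entropySeq (τ t))) =ᶠ[𝓝 0] fun _ => 0 :=
    crit.mono fun t ht => ht.2
  have coordinate (k : ℕ) : (fun t => deriv entropySeq (τ t) k) =ᶠ[𝓝 0]
      fun t => deriv (rllCondEntropy k) (τ t) :=
    crit.mono fun t ht => deriv_entropySeq_apply ht.1 k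
  have leibniz := iteratedDeriv_geomEval curve n
  rw [vanishes.iteratedDeriv_eq, iteratedDeriv_fun_const_zero] at leibniz
  rw [derivs, ← optimalParam_zero, ← value]
  refine Eq.trans (Finset.sum_congr rfl fun k _ => ?_) leibniz.symm
  rw [(coordinate k).iteratedDeriv_eq, iteratedDeriv_deriv_comp_eq_sum_brunoTerm hτ.contDiffAt
    (analyticAt_rllCondEntropy mem k).deriv.contDiffAt]

theorem derivAtZero_optimalParam (n : ℕ) (hn : 1 ≤ n) :
    derivAtZero optimalParam n =
      -(iteratedDeriv 2 (rllCondEntropy 0) (1 / Real.goldenRatio ^ 2))⁻¹ *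
        ((∑ k ∈ Finset.Icc 1 n, (n.choose k : ℝ) * (k ! : ℝ) *
            ∑ m ∈ bruno (n - k), brunoTerm (rllCondEntropy k) (1 / Real.goldenRatio ^ 2)
              (derivAtZero optimalParam) m) +
          ∑ m ∈ bruno n with ∀ i : Fin n, (i : ℕ) + 1 = n → m i = 0,
            brunoTerm (rllCondEntropy 0) (1 / Real.goldenRatio ^ 2)
              (derivAtZero optimalParam) m) := by
  obtain ⟨N, rfl⟩ := Nat.exists_eq_add_of_le' hn
  have total := sum_sum_brunoTerm_eq_zero (N + 1)
  rw [Finset.range_eq_Ico, Finset.sum_eq_sum_Ico_succ_bot (Nat.succ_pos _),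
    show Finset.Ico (0 + 1) (N + 1 + 1) = Finset.Icc 1 (N + 1) from rfl, Nat.choose_zero_right,
    Nat.factorial_zero, Nat.cast_one, mul_one, one_mul, Nat.sub_zero, sum_brunoTerm_succ] at total
  rw [neg_mul, ← mul_neg, eq_inv_mul_iff_mul_eq₀ iteratedDeriv_two_rllCondEntropy_ne_zero]
  linarith

/-! ### The Taylor series of the capacity -/

/-- The coefficients of the product of `(1 - ε) ^ 2` and the power series with coefficients `x`. -/
def secondDifference : (ℕ →ᵇ ℝ) →L[ℝ] (ℕ →ᵇ ℝ) :=
  .id ℝ _ - (2 : ℝ) • rightShift + rightShift ∘L rightShift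

@[simp] lemma secondDifference_zero (x : ℕ →ᵇ ℝ) : secondDifference x 0 = x 0 := by
  simp [secondDifference]

@[simp] lemma secondDifference_one (x : ℕ →ᵇ ℝ) : secondDifference x 1 = x 1 - 2 * x 0 := by
  simp [secondDifference, rightShift_succ x 0, rightShift_succ (rightShift x) 0]

@[simp] lemma secondDifference_add_two (x : ℕ →ᵇ ℝ) (k : ℕ) :
    secondDifference x (k + 2) = x (k + 2) + x k - 2 * x (k + 1) := by
  simp only [secondDifference, add_apply, sub_apply, ContinuousLinearMap.id_apply, smul_apply,
    ContinuousLinearMap.comp_apply, BoundedContinuousFunction.coe_add,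
    BoundedContinuousFunction.coe_sub, BoundedContinuousFunction.coe_smul, smul_eq_mul,
    Pi.add_apply, Pi.sub_apply, rightShift_succ]
  ring

lemma geomEval_secondDifference {ε : ℝ} (hε : |ε| < 1) (x : ℕ →ᵇ ℝ) :
    geomEval ε (secondDifference x) = (1 - ε) ^ 2 * geomEval ε x := by
  simp only [secondDifference, add_apply, sub_apply, ContinuousLinearMap.id_apply, smul_apply,
    ContinuousLinearMap.comp_apply, map_add, map_sub, map_smul, geomEval_rightShift hε, smul_eq_mul]
  ring

lemma sum_range_succ_eq_add_sum_Icc_two (f : ℕ → ℝ) (n : ℕ) :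
    ∑ k ∈ Finset.range (n + 1), f k =
      f 0 + (if n = 0 then 0 else f 1) + ∑ k ∈ Finset.Icc 2 n, f k := by
  rw [Finset.range_eq_Ico, Finset.sum_eq_sum_Ico_succ_bot (Nat.succ_pos n)]
  rcases n with _ | n
  · simp
  · rw [Finset.sum_eq_sum_Ico_succ_bot (Nat.succ_lt_succ n.succ_pos), if_neg n.succ_ne_zero,
      ← add_assoc]
    rfl

lemma capacityCoeff_eq {x : ℝ → ℕ →ᵇ ℝ} {G : ℕ → ℝ → ℝ} (hx : AnalyticAt ℝ x 0)
    (hG : ∀ᶠ t in 𝓝[Ico 0 1] 0, ∀ k, G k t = x t k) (n : ℕ) :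
    capacityCoeff G n = iteratedDeriv n (fun t => (1 - t) ^ 2 * geomEval t (x t)) 0 := by
  have analytic : AnalyticAt ℝ (fun t => secondDifference (x t)) 0 :=
    (secondDifference.analyticAt _).fun_comp hx
  have product : (fun t => (1 - t) ^ 2 * geomEval t (x t)) =ᶠ[𝓝 0]
      fun t => geomEval t (secondDifference (x t)) := by
    filter_upwards [eventually_abs_sub_lt 0 one_pos] with t ht
      using (geomEval_secondDifference (by simpa using ht) _).symm
  have coefficient {g : ℝ → ℝ} (k : ℕ) (h : ∀ t, (∀ j, G j t = x t j) →
      g t = secondDifference (x t) k) (j : ℕ) :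
      derivAtZero g j = iteratedDeriv j (fun t => secondDifference (x t) k) 0 :=
    derivAtZero_eq (hG.mono h) (analyticAt_coordinate analytic k) j
  rw [product.iteratedDeriv_eq, iteratedDeriv_geomEval analytic,
    sum_range_succ_eq_add_sum_Icc_two, capacityCoeff,
    coefficient 0 fun t ht => by simp [ht], coefficient 1 fun t ht => by simp [ht]]
  congr 1
  · rcases n with _ | n <;> simp
  · refine Finset.sum_congr rfl fun k hk => ?_
    obtain ⟨j, rfl⟩ := Nat.exists_eq_add_of_le' (Finset.mem_Icc.1 hk).1
    rw [coefficient (j + 2) fun t ht => by simp [ht]]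

theorem hasSum_markovCapacity : ∃ r : ℝ, 0 < r ∧ ∀ ε ∈ Ico (0 : ℝ) r,
    HasSum (fun n : ℕ => capacityCoeff (entropyAlong optimalParam) n / (n ! : ℝ) * ε ^ n)
      (markovCapacity ε) := by
  obtain ⟨τ, hτ, value, crit, eq⟩ := exists_analyticAt_optimalParam zero_mem_Ico
  have curve : AnalyticAt ℝ (fun t => entropySeq (τ t)) 0 :=
    analyticAt_entropySeq_comp hτ (value ▸ optimalParam_mem zero_mem_Ico)
  have entries : ∀ᶠ t in 𝓝[Ico 0 1] 0, ∀ k,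
      entropyAlong optimalParam k t = entropySeq (τ t) k := by
    filter_upwards [eq, nhdsWithin_le_nhds crit] with t ht mem k
    rw [entropyAlong, ht, entropySeq_apply (Ioo_subset_Icc_self mem.1)]
  have taylor := hasFPowerSeriesAt_iff.1
    (analyticAt_sq_mul_geomEval (by simp) curve).hasFPowerSeriesAt
  have near := (markovCapacity_eventuallyEq eq).and (nhdsWithin_le_nhds taylor)
  rw [nhdsWithin_Ico_eq_nhdsGE one_pos] at near
  obtain ⟨r, pos, subset⟩ := mem_nhdsGE_iff_exists_Ico_subset.1 near
  refine ⟨r, pos, fun ε hε => ?_⟩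
  obtain ⟨capacity, sum⟩ := subset hε
  rw [capacity]
  simpa [capacityCoeff_eq curve entries, mul_comm] using sum

end BEC

end

theorem mainTheorem3 :
    -- the mutual information rate of every admissible input exists as a limit
    (∀ ε ∈ Ico (0 : ℝ) 1, ∀ (π : BEC.Letter → ℝ) (P : Matrix BEC.Letter BEC.Letter ℝ),
      BEC.IsStationaryChain π P → BEC.SupportedOn BEC.rllConstraint π P →
        Tendsto (BEC.blockInfo ε π P) atTop (𝓝 (BEC.infoRate ε π P))) ∧
    ∃ θmax : ℝ → ℝ,
      (∀ ε ∈ Ico (0 : ℝ) 1, BEC.IsOptimalParam ε (θmax ε)) ∧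
      θmax 0 = 1 / Real.goldenRatio ^ 2 ∧
      -- a) analyticity of the optimal parameter and its derivatives at `0`
      AnalyticOn ℝ θmax (Ico 0 1) ∧
      (∀ n : ℕ, 1 ≤ n →
        BEC.derivAtZero θmax n =
          -(iteratedDeriv 2 (BEC.rllCondEntropy 0) (1 / Real.goldenRatio ^ 2))⁻¹ *
            ((∑ k ∈ Finset.Icc 1 n, (n.choose k : ℝ) * (k ! : ℝ) *
                ∑ m ∈ BEC.bruno (n - k),
                  BEC.brunoTerm (BEC.rllCondEntropy k) (1 / Real.goldenRatio ^ 2) (BEC.derivAtZero θmax) m) +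
              ∑ m ∈ BEC.bruno n with ∀ i : Fin n, (i : ℕ) + 1 = n → m i = 0,
                BEC.brunoTerm (BEC.rllCondEntropy 0) (1 / Real.goldenRatio ^ 2) (BEC.derivAtZero θmax) m)) ∧
      iteratedDeriv 2 (BEC.rllCondEntropy 0) (1 / Real.goldenRatio ^ 2) ≠ 0 ∧
      -- b) analyticity of the capacity and its Taylor series at `0`
      (∀ ε ∈ Ico (0 : ℝ) 1,
        IsLUB (BEC.markovRates ε) (BEC.markovCapacity ε) ∧
        BEC.markovCapacity ε = BEC.rllRate ε (θmax ε)) ∧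
      AnalyticOn ℝ BEC.markovCapacity (Ico 0 1) ∧
      (∀ k : ℕ, AnalyticOn ℝ (BEC.entropyAlong θmax k) (Ico 0 1)) ∧
      ∃ r : ℝ, 0 < r ∧ ∀ ε ∈ Ico (0 : ℝ) r,
        HasSum (fun n : ℕ => BEC.capacityCoeff (BEC.entropyAlong θmax) n / (n ! : ℝ) * ε ^ n)
          (BEC.markovCapacity ε) :=
  ⟨fun _ hε _ _ h _ => by
    rw [BEC.infoRate_eq h hε]
    exact BEC.tendsto_blockInfo h hε,
  BEC.optimalParam, fun _ hε => BEC.isOptimalParam_optimalParam hε, BEC.optimalParam_zero,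
  BEC.analyticOn_optimalParam, BEC.derivAtZero_optimalParam,
  BEC.iteratedDeriv_two_rllCondEntropy_ne_zero,
  fun _ hε => ⟨BEC.isLUB_markovCapacity hε, BEC.markovCapacity_eq hε⟩,
  BEC.analyticOn_markovCapacity, BEC.analyticOn_entropyAlong, BEC.hasSum_markovCapacity⟩
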